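/- Let $d\ge 0$, $T>0$, and for $j=1,\dots,d$ let $D^j,\delta^j,\kappa_j\in\mathbb R$ (tick sizes, sensitivities, risk penalties), $m^j>0$ (order sizes), $\Lambda^{j,b},\Lambda^{j,a}\ge 0$ (execution intensities), and $Q^j$ a nonnegative integer multiple of $m^j$; let $\mu,\sigma,\kappa\in\mathbb R$. Put $\mathcal Q^j=\{-Q^j,-Q^j+m^j,\dots,Q^j\}$, $\mathcal Q=\prod_j\mathcal Q^j$, $\phi^b=1$, $\phi^a=-1$, and let $(e^j)$ be the canonical basis of $\mathbb R^d$. Let $v:[0,T]\times\mathcal Q\to\mathbb R$ be $C^1$ in time and solve, for all $(t,q)\in[0,T]\times\mathcal Q$, $$0=-\partial_t v(t,q)-\mu\sum_j q^j\delta^j+\sum_j\tfrac{\kappa_j}{2}\sigma^2(q^j\delta^j)^2+\tfrac{\kappa}{2}\sigma^2\Big(\sum_j q^j\delta^j\Big)^2-\sum_j\sum_{k=a,b}\mathbf 1_{\{q^j+\phi^km^j\in\mathcal Q^j\}}\sup_{l\in\{0,1\}} l\,\Lambda^{j,k}\Big(m^j\tfrac{D^j}{2}+v(t,q+\phi^km^je^j)-v(t,q)\Big),$$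 with $v(T,q)=0$. Fix $(t,q)\in[0,T]\times\mathcal Q$. An admissible control on $[t,T]$ consists of a filtered probability space, predictable $\{0,1\}$-valued processes $l^{j,k}$ ($1\le j\le d$, $k\in\{a,b\}$) and adapted counting processes $N^{j,k}$ with unit jumps, without common jumps, equal to $0$ up to time $t$, such that, with $q_s^j=q^j+m^jN^{j,b}_s-m^jN^{j,a}_s$, the process $N^{j,k}$ has on $(t,T]$ the intensity $\lambda^{j,k}_s=l^{j,k}_s\Lambda^{j,k}\mathbf 1_{\{q^j_s+\phi^km^j\in\mathcal Q^j\}}$, i.e. $\mathbb E\int_{(t,T]}C_s\,dN^{j,k}_s=\mathbb E\int_t^TC_s\lambda^{j,k}_s\,ds$ for every predictable $C\ge 0$. Its performance is the expectation of $$\int_t^T\sum_{j}\Big(\sum_{k=a,b}\tfrac{D^j}{2}m^jl^{j,k}_s\Lambda^{j,k}\mathbf 1_{\{q^j_s+\phi^km^j\in\mathcal Q^j\}}+q^j_s\delta^j\mu\Big)ds-\sum_j\tfrac{\kappa_j}{2}\sigma^2\int_t^T(q^j_s\delta^j)^2ds-\tfrac{\kappa}{2}\sigma^2\int_t^T\Big(\sum_jq^j_s\delta^j\Big)^2ds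 .$$ Then: (i) for every admissible control this random variable is integrable; (ii) there is an admissible control that follows the feedback rule $$l^{j,k}_s=1\iff q^j_{s-}+\phi^km^j\in\mathcal Q^j\ \text{ and }\ \frac{v(s,q_{s-})-v(s,q_{s-}+\phi^km^je^j)}{m^j}\le\frac{D^j}{2},\qquad s\in(t,T];$$ (iii) every admissible control that follows this rule is optimal: its performance is at least that of every admissible control; (iv) $v(t,q)$ is the supremum of the performances of all admissible controls. -/

import Mathlib

open MeasureTheory Set
open scoped ENNReal

/-- The two sides of the book on which a limit order may be posted. -/
inductive Side where
  | bid
  | ask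
  deriving DecidableEq

instance : Fintype Side where
  elems := {Side.bid, Side.ask}
  complete := fun k => by cases k <;> simp

/-- `φ^b = +1` (a bid fill increases the inventory), `φ^a = -1`. -/
def Side.sign : Side → ℝ
  | Side.bid => 1
  | Side.ask => -1

/-- The constants of the approximated market making problem with `d` assets. -/
structure Market (d : ℕ) where
  /-- time horizon -/
  T : ℝ
  /-- drift of the underlying -/
  μ : ℝ
  /-- volatility of the underlying -/
  σ : ℝ
  /-- penalization of the net risk of the portfolio -/
  κ : ℝ
  /-- penalizations of the risks of the individual assets -/
  κa : Fin d → ℝ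
  /-- sensitivities of the assets to the underlying -/
  δ : Fin d → ℝ
  /-- tick sizes -/
  D : Fin d → ℝ
  /-- order sizes -/
  m : Fin d → ℝ
  /-- maximal inventories -/
  Q : Fin d → ℝ
  /-- execution intensities of a posted order -/
  Λ : Fin d → Side → ℝ
  T_pos : 0 < T
  m_pos : ∀ j, 0 < m j
  Λ_nonneg : ∀ j k, 0 ≤ Λ j k
  Q_multiple : ∀ j, ∃ n : ℕ, Q j = n * m j

noncomputable section

namespace Market

variable {d : ℕ}

/-- `𝒬^j = {-Q^j, -Q^j + m^j, …, Q^j}`. -/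
def levels (M : Market d) (j : Fin d) : Set ℝ :=
  {x | ∃ i : ℕ, x = -M.Q j + i * M.m j ∧ x ≤ M.Q j}

/-- `𝒬 = ∏ⱼ 𝒬^j`. -/
def inventories (M : Market d) : Set (Fin d → ℝ) :=
  {q | ∀ j, q j ∈ M.levels j}

/-- `q + φ^k m^j e^j`, the inventory after a fill on side `k` of asset `j`. -/
def shift (M : Market d) (q : Fin d → ℝ) (j : Fin d) (k : Side) : Fin d → ℝ :=
  q + Pi.single j (k.sign * M.m j)

/-- The indicator of `q^j + φ^k m^j ∈ 𝒬^j`. -/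
def room (M : Market d) (q : Fin d → ℝ) (j : Fin d) (k : Side) : ℝ :=
  (M.levels j).indicator (fun _ => 1) (q j + k.sign * M.m j)

/-- `v` solves the Hamilton-Jacobi-Bellman system on `[0,T] × 𝒬`, is `C¹` in time, and vanishes
at time `T`. The values of `v` off `[0,T] × 𝒬` are irrelevant. -/
structure IsHJBSolution (M : Market d) (v : ℝ → (Fin d → ℝ) → ℝ) : Prop where
  contDiffOn : ∀ q ∈ M.inventories, ContDiffOn ℝ 1 (fun t => v t q) (Icc 0 M.T)
  equation : ∀ t ∈ Icc 0 M.T, ∀ q ∈ M.inventories,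
    0 = - derivWithin (fun s => v s q) (Icc 0 M.T) t
      - M.μ * ∑ j, q j * M.δ j
      + ∑ j, M.κa j / 2 * M.σ ^ 2 * (q j * M.δ j) ^ 2
      + M.κ / 2 * M.σ ^ 2 * (∑ j, q j * M.δ j) ^ 2
      - ∑ j, ∑ k, M.room q j k *
          sSup ((fun l : ℝ => l * M.Λ j k * (M.m j * (M.D j / 2) + v t (M.shift q j k) - v t q))
            '' {0, 1})
  terminal : ∀ q ∈ M.inventories, v M.T q = 0

open Classical in
/-- The feedback rule read off `v`: `1` means that an order is posted on side `k` of asset `j`. -/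
def feedback (M : Market d) (v : ℝ → (Fin d → ℝ) → ℝ) (t : ℝ) (q : Fin d → ℝ)
    (j : Fin d) (k : Side) : ℝ :=
  if q j + k.sign * M.m j ∈ M.levels j ∧ (v t q - v t (M.shift q j k)) / M.m j ≤ M.D j / 2
  then 1 else 0

/-- The inventory `q^j + m^j n^{j,b} - m^j n^{j,a}` reached from `q` after `n^{j,k}` fills. -/
def inventory (M : Market d) (q : Fin d → ℝ) (n : Fin d → Side → ℕ) : Fin d → ℝ :=
  fun j => q j + M.m j * n j Side.bid - M.m j * n j Side.ask

end Market

/-- The predictable σ-algebra on `ℝ × Ω` of a filtration indexed by `ℝ`, generated by the sets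
`(u, ∞) × A` with `A ∈ 𝓕 u`. (Mathlib's `Filtration.predictable` needs a least time.) -/
@[reducible]
def predictableσ {Ω : Type} {mΩ : MeasurableSpace Ω} (𝓕 : Filtration ℝ mΩ) :
    MeasurableSpace (ℝ × Ω) :=
  MeasurableSpace.generateFrom {s | ∃ u A, MeasurableSet[𝓕 u] A ∧ s = Ioi u ×ˢ A}

/-- A path of a simple counting process started from `0` at time `t`. -/
structure IsCountingPath (t : ℝ) (n : ℝ → ℕ) : Prop where
  start : ∀ s ≤ t, n s = 0
  mono : Monotone n
  right_continuous : ∀ s, ContinuousWithinAt n (Ici s) s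
  unit_jumps : ∀ s, n s ≤ Function.leftLim n s + 1

/-- The jump `n_s - n_{s-}` of a counting path. -/
def jumpAt (n : ℝ → ℕ) (s : ℝ) : ℕ := n s - Function.leftLim n s

/-- `lam` is the `𝓕`-intensity of the counting process `N` on `(t,T]`:
`E ∫_{(t,T]} C_s dN_s = E ∫_t^T C_s lam_s ds` for all nonnegative predictable `C`. -/
def HasIntensity {Ω : Type} {mΩ : MeasurableSpace Ω} (P : Measure Ω) (𝓕 : Filtration ℝ mΩ)
    (t T : ℝ) (N : ℝ → Ω → ℕ) (lam : ℝ → Ω → ℝ) : Prop :=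
  ∀ C : ℝ → Ω → ℝ≥0∞, Measurable[predictableσ 𝓕] (Function.uncurry C) →
    ∫⁻ ω, (∑' s : Ioc t T, C s ω * (jumpAt (fun r => N r ω) s : ℝ≥0∞)) ∂P =
      ∫⁻ ω, (∫⁻ s in Ioc t T, C s ω * ENNReal.ofReal (lam s ω)) ∂P

/-- An admissible control on `[t,T]` from inventory `q`, with the transactions that it gives rise
to: a filtered probability space, predictable `{0,1}`-valued participation decisions `l`, and
counting processes `N^{j,k}` without common jumps whose intensities are
`l^{j,k} Λ^{j,k} 1{q^j + φ^k m^j ∈ 𝒬^j}`. -/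
structure ControlledSystem {d : ℕ} (M : Market d) (t : ℝ) (q : Fin d → ℝ) where
  Ω : Type
  mΩ : MeasurableSpace Ω
  P : Measure Ω
  isProbability : IsProbabilityMeasure P
  𝓕 : Filtration ℝ mΩ
  N : Fin d → Side → ℝ → Ω → ℕ
  l : Fin d → Side → ℝ → Ω → ℝ
  adapted : ∀ j k s, Measurable[𝓕 s] (N j k s)
  counting : ∀ j k ω, IsCountingPath t (fun s => N j k s ω)
  no_common_jumps : ∀ ω s j k j' k', jumpAt (fun r => N j k r ω) s ≠ 0 →
    jumpAt (fun r => N j' k' r ω) s ≠ 0 → j = j' ∧ k = k'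
  control_mem : ∀ j k s ω, l j k s ω = 0 ∨ l j k s ω = 1
  control_predictable : ∀ j k, Measurable[predictableσ 𝓕] (Function.uncurry (l j k))
  intensity : ∀ j k, HasIntensity P 𝓕 t M.T (N j k)
    (fun s ω => l j k s ω * M.Λ j k * M.room (M.inventory q (fun i h => N i h s ω)) j k)

namespace ControlledSystem

variable {d : ℕ} {M : Market d} {t : ℝ} {q : Fin d → ℝ}

/-- The inventory `q_s`. -/
def inv (S : ControlledSystem M t q) (s : ℝ) (ω : S.Ω) : Fin d → ℝ :=
  M.inventory q (fun j k => S.N j k s ω)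

/-- The inventory `q_{s-}` just before time `s`. -/
def invLeft (S : ControlledSystem M t q) (s : ℝ) (ω : S.Ω) : Fin d → ℝ :=
  M.inventory q (fun j k => Function.leftLim (fun r => S.N j k r ω) s)

/-- The random variable whose expectation is maximized. -/
def payoff (S : ControlledSystem M t q) (ω : S.Ω) : ℝ :=
  (∫ s in t..M.T, ∑ j, ((∑ k, M.D j / 2 * M.m j * S.l j k s ω * M.Λ j k * M.room (S.inv s ω) j k)
      + S.inv s ω j * M.δ j * M.μ))
    - ∑ j, M.κa j / 2 * M.σ ^ 2 * (∫ s in t..M.T, (S.inv s ω j * M.δ j) ^ 2)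
    - M.κ / 2 * M.σ ^ 2 * (∫ s in t..M.T, (∑ j, S.inv s ω j * M.δ j) ^ 2)

/-- The performance of the control: the expected payoff. -/
def performance (S : ControlledSystem M t q) : ℝ := @integral S.Ω ℝ _ _ S.mΩ S.P S.payoff

/-- The decisions are those of the feedback rule read off `v`:
`l^{j,k}_s = l^{j,k∗}_s(q_{s-})` on `(t,T]`. -/
def FollowsFeedback (S : ControlledSystem M t q) (v : ℝ → (Fin d → ℝ) → ℝ) : Prop :=
  ∀ s ∈ Ioc t M.T, ∀ ω j k, S.l j k s ω = M.feedback v s (S.invLeft s ω) j k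

end ControlledSystem

end

/-! The optimality part is a verification argument with an exact remainder. For every admissible
control, `value_eq_performance_add` shows that `v t q` is the performance plus the expected time
integral of `loss`, the gap between the maximum in the Hamilton-Jacobi-Bellman equation and what the
chosen decisions achieve. The gap is nonnegative because decisions are 0 or 1, and it vanishes
almost everywhere under the feedback rule (`feedback_mul`). So `v t q` bounds every performance and
equals that of any control following the rule.

The identity comes from `dynkin` applied to `v`. Along each path, `sub_eq_integral_add_sum_jumps`
writes the change of a function of time and fills as a time integral plus finitely many jumps. The
jump sums have predictable integrands, and `HasIntensity.integral_sum_jump` replaces them in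
expectation by integrals against the intensities. The equation is known only on `𝒬`, so the
inventory must be shown to stay there; the intensities give this only up to null sets, and
`ae_inv_mem` extracts it from a second use of `dynkin`. As `𝒬` is finite, every quantity involved is
then bounded, which also gives integrability.

It remains to build a control that follows the rule. Potential fills form a finite marked Poisson
process, realised as a weighted sum of product measures over the number of points. They are thinned
in order of time: a point is kept if the rule allows it after the fills kept earlier. The intensity
is a Mecke computation (`hasIntensity_upTo`): one point is integrated out, and a predictable
integrand evaluated at that point's time does not notice its presence (`predictable_insert`). -/

open Filter Topology

/-! ### Counting paths: local constancy and finiteness of jumps. -/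

namespace IsCountingPath

variable {t : ℝ} {n : ℝ → ℕ}

lemma eventually_left (h : IsCountingPath t n) (s : ℝ) :
    ∀ᶠ r in 𝓝[<] s, n r = Function.leftLim n s := by
  have := h.mono.tendsto_leftLim s
  rw [nhds_discrete, tendsto_pure] at this
  exact this

lemma eventually_right (h : IsCountingPath t n) (s : ℝ) :
    ∀ᶠ r in 𝓝[≥] s, n r = n s := by
  have := h.right_continuous s
  rw [ContinuousWithinAt, nhds_discrete, tendsto_pure] at this
  exact this

lemma leftLim_add_jumpAt (h : IsCountingPath t n) (s : ℝ) :
    Function.leftLim n s + jumpAt n s = n s := by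
  have := h.mono.leftLim_le (le_refl s)
  unfold jumpAt
  omega

lemma jumpAt_le_one (h : IsCountingPath t n) (s : ℝ) : jumpAt n s ≤ 1 := by
  have := h.unit_jumps s
  unfold jumpAt
  omega

/-- The count rises strictly at each jump, so `n` is injective on the jump times, and its values
there are naturals at most `n T`. -/
lemma finite_jumps (h : IsCountingPath t n) (T : ℝ) :
    {s | s ∈ Ioc t T ∧ jumpAt n s ≠ 0}.Finite := by
  refine Set.Finite.of_injOn (f := n) (t := Iic (n T)) ?_ ?_ (finite_Iic _)
  · intro s hs
    exact h.mono hs.1.2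
  · have key : ∀ s r, s < r → jumpAt n r ≠ 0 → n s < n r := by
      intro s r hsr hr
      have h1 := h.mono.le_leftLim hsr
      have h2 := h.leftLim_add_jumpAt r
      omega
    intro s hs r hr hsr
    rcases lt_trichotomy s r with h1 | h1 | h1
    · have := key s r h1 hr.2
      omega
    · exact h1
    · have := key r s h1 hs.2
      omega

/-- Only countably many times, all strictly before `s`, are involved; this is what makes left limits
predictable. -/
lemma le_leftLim_iff (h : IsCountingPath t n) (s : ℝ) (k : ℕ) :
    k ≤ Function.leftLim n s ↔ ∃ r : ℚ, (r : ℝ) < s ∧ k ≤ n r := by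
  constructor
  · intro hk
    obtain ⟨a, ha, hs⟩ := (mem_nhdsLT_iff_exists_Ioo_subset).1 (h.eventually_left s)
    obtain ⟨r, h1, h2⟩ := exists_rat_btwn (mem_Iio.1 ha)
    have : n r = Function.leftLim n s := hs ⟨h1, h2⟩
    exact ⟨r, h2, by omega⟩
  · rintro ⟨r, hr, hk⟩
    exact hk.trans (h.mono.le_leftLim hr)

lemma lt_iff (h : IsCountingPath t n) (s : ℝ) (k : ℕ) :
    n s < k ↔ ∃ r : ℚ, s < (r : ℝ) ∧ n r < k := by
  constructor
  · intro hk
    have h1 : ∀ᶠ r in 𝓝[>] s, n r = n s :=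
      (h.eventually_right s).filter_mono (nhdsWithin_mono _ Ioi_subset_Ici_self)
    obtain ⟨a, ha, hs⟩ := (mem_nhdsGT_iff_exists_Ioo_subset).1 h1
    obtain ⟨r, h1, h2⟩ := exists_rat_btwn (mem_Ioi.1 ha)
    have : n r = n s := hs ⟨h1, h2⟩
    exact ⟨r, h1, by omega⟩
  · rintro ⟨r, hr, hk⟩
    exact (h.mono hr.le).trans_lt hk

end IsCountingPath

/-! ### Change of variables along piecewise constant paths. -/

/-- The change of `w (s, p s)` along a piecewise constant path `p` is the integral of the time
derivative of `w` plus the sum of the jumps. -/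
lemma sub_eq_integral_add_sum_jumps {E : Type*} {t T : ℝ} (htT : t ≤ T) {p pL : ℝ → E}
    (hright : ∀ s, ∀ᶠ r in 𝓝[≥] s, p r = p s) (hleft : ∀ s, ∀ᶠ r in 𝓝[<] s, p r = pL s)
    (J : Finset ℝ) (hJ : ∀ s ∈ Ioc t T, s ∉ J → p s = pL s) (hJt : ∀ s ∈ J, t < s)
    (hJT : ∀ s ∈ J, s ≤ T)
    (w w' : ℝ → E → ℝ)
    (hw : ∀ e, ∀ a ∈ Icc t T, ∀ b ∈ Icc t T, a ≤ b → ∫ r in a..b, w' r e = w b e - w a e)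
    (hint : IntervalIntegrable (fun r => w' r (p r)) volume t T) :
    w T (p T) - w t (p t) =
      (∫ r in t..T, w' r (p r)) + ∑ s ∈ J, (w s (p s) - w s (pL s)) := by
  -- `G` is the defect of the formula at time `s`. It is locally constant from both sides on `[t,
  -- T]`, hence constant there.
  set G : ℝ → ℝ := fun s => w s (p s) - (∫ r in t..s, w' r (p r)) -
    ∑ r ∈ J with r ≤ s, (w r (p r) - w r (pL r)) with hG
  have hsub : ∀ a ∈ Icc t T, ∀ b ∈ Icc t T, IntervalIntegrable (fun r => w' r (p r)) volume a b :=
    fun a ha b hb => hint.mono_set (by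
      rw [uIcc_of_le htT]
      exact uIcc_subset_Icc ha hb)
  have hinc : ∀ a ∈ Icc t T, ∀ b ∈ Icc t T, a ≤ b → G b - G a = w b (p b) - w a (p a) -
      (∫ r in a..b, w' r (p r)) - ∑ r ∈ J with a < r ∧ r ≤ b, (w r (p r) - w r (pL r)) := by
    intro a ha b hb hab
    have h1 := intervalIntegral.integral_add_adjacent_intervals
      (hsub t ⟨le_rfl, htT⟩ a ha) (hsub a ha b hb)
    have h2 : ∑ r ∈ J with r ≤ b, (w r (p r) - w r (pL r)) =
        ∑ r ∈ J with r ≤ a, (w r (p r) - w r (pL r)) +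
        ∑ r ∈ J with a < r ∧ r ≤ b, (w r (p r) - w r (pL r)) := by
      rw [← Finset.sum_union]
      · congr 1
        ext r
        simp only [Finset.mem_filter, Finset.mem_union]
        constructor
        · rintro ⟨h, h'⟩
          rcases le_or_gt r a with h3 | h3
          · exact Or.inl ⟨h, h3⟩
          · exact Or.inr ⟨h, h3, h'⟩
        · rintro (⟨h, h'⟩ | ⟨h, h', h''⟩)
          · exact ⟨h, h'.trans hab⟩
          · exact ⟨h, h''⟩
      · rw [Finset.disjoint_filter]
        intro r _ h3 h4
        exact absurd h3 (not_le.2 h4.1)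
    simp only [hG]
    rw [← h1, h2]
    ring
  -- constancy just to the right
  have hR : ∀ s ∈ Icc t T, ∀ᶠ r in 𝓝[≥] s, r ∈ Icc t T → G r = G s := by
    intro s hs
    have h0 := hright s
    have h1 : ∀ᶠ r in 𝓝[≥] s, ∀ x ∈ J, s < x → r < x := by
      rw [eventually_all_finset]
      intro x _
      by_cases hx : s < x
      · exact ((eventually_lt_nhds hx).filter_mono nhdsWithin_le_nhds).mono fun r hr _ => hr
      · exact Eventually.of_forall fun r h => absurd h hx
    obtain ⟨b, hb, hb'⟩ := (mem_nhdsGE_iff_exists_Ico_subset).1 (h0.and h1)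
    filter_upwards [Ico_mem_nhdsGE hb] with r hr hrI
    have h2 := hinc s hs r hrI hr.1
    have h3 : ∫ x in s..r, w' x (p x) = ∫ x in s..r, w' x (p s) := by
      apply intervalIntegral.integral_congr
      intro x hx
      rw [uIcc_of_le hr.1] at hx
      have : p x = p s := (hb' ⟨hx.1, hx.2.trans_lt hr.2⟩).1
      simp only [this]
    have h4 : (J.filter fun x => s < x ∧ x ≤ r) = ∅ := by
      rw [Finset.filter_eq_empty_iff]
      rintro x hx ⟨h5, h6⟩
      exact absurd h6 (not_le.2 ((hb' hr).2 x hx h5))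
    have h5 : p r = p s := (hb' hr).1
    rw [h3, h4, hw _ s hs r hrI hr.1, h5] at h2
    simp only [Finset.sum_empty] at h2
    linarith
  -- Just to the left the path equals `pL s`, and the only jump that can lie in `(r, s]` is the one
  -- at `s`, which accounts for the passage from `pL s` to `p s`.
  have hL : ∀ s ∈ Icc t T, ∀ᶠ r in 𝓝[<] s, r ∈ Icc t T → G r = G s := by
    intro s hs
    have h0 := hleft s
    have h1 : ∀ᶠ r in 𝓝[<] s, ∀ x ∈ J, x < s → x < r := by
      rw [eventually_all_finset]
      intro x _
      by_cases hx : x < s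
      · exact ((eventually_gt_nhds hx).filter_mono nhdsWithin_le_nhds).mono fun r hr _ => hr
      · exact Eventually.of_forall fun r h => absurd h hx
    obtain ⟨b, hb, hb'⟩ := (mem_nhdsLT_iff_exists_Ioo_subset).1 (h0.and h1)
    filter_upwards [Ioo_mem_nhdsLT hb] with r hr hrI
    have h2 := hinc r hrI s hs hr.2.le
    have h3 : ∫ x in r..s, w' x (p x) = ∫ x in r..s, w' x (pL s) := by
      apply intervalIntegral.integral_congr_ae
      have : ∀ᵐ x ∂(volume : Measure ℝ), x ≠ s := by simp [ae_iff]
      filter_upwards [this] with x hxs hx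
      rw [uIoc_of_le hr.2.le] at hx
      have : p x = pL s := (hb' ⟨hr.1.trans hx.1, lt_of_le_of_ne hx.2 hxs⟩).1
      simp only [this]
    have h5 : p r = pL s := (hb' hr).1
    rw [h3, hw _ r hrI s hs hr.2.le, h5] at h2
    have h4 : ∑ x ∈ J with r < x ∧ x ≤ s, (w x (p x) - w x (pL x)) =
        w s (p s) - w s (pL s) := by
      have hsub : ∀ x ∈ J, r < x ∧ x ≤ s → x = s := by
        rintro x hx ⟨h6, h7⟩
        rcases h7.lt_or_eq with h8 | h8
        · exact absurd ((hb' hr).2 x hx h8) (not_lt.2 h6.le)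
        · exact h8
      by_cases hsJ : s ∈ J
      · have : (J.filter fun x => r < x ∧ x ≤ s) = {s} := by
          ext x
          simp only [Finset.mem_filter, Finset.mem_singleton]
          constructor
          · rintro ⟨h, h'⟩
            exact hsub x h h'
          · rintro rfl
            exact ⟨hsJ, hr.2, le_rfl⟩
        rw [this, Finset.sum_singleton]
      · have : (J.filter fun x => r < x ∧ x ≤ s) = ∅ := by
          rw [Finset.filter_eq_empty_iff]
          intro x hx h
          exact hsJ (hsub x hx h ▸ hx)
        rw [this, Finset.sum_empty, hJ s ⟨hrI.1.trans_lt hr.2, hs.2⟩ hsJ]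
        ring
    rw [h4] at h2
    linarith
  have hconst : G T = G t := by
    refine constant_of_has_deriv_right_zero (f := G) (a := t) (b := T) ?_ ?_ T ⟨htT, le_rfl⟩
    · intro s hs
      have hall : ∀ᶠ r in 𝓝 s, r ∈ Icc t T → G r = G s := by
        rw [← nhdsLT_sup_nhdsGE, eventually_sup]
        exact ⟨hL s hs, hR s hs⟩
      have : G =ᶠ[𝓝[Icc t T] s] fun _ => G s := by
        rw [EventuallyEq, eventually_nhdsWithin_iff]
        exact hall
      exact (continuousWithinAt_const (b := G s)).congr_of_eventuallyEq this rfl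
    · intro s hs
      have hs' : s ∈ Icc t T := ⟨hs.1, hs.2.le⟩
      have h1 : G =ᶠ[𝓝[≥] s] fun _ => G s := by
        filter_upwards [hR s hs', Ico_mem_nhdsGE hs.2] with r hr hr2
        exact hr ⟨hs.1.trans hr2.1, hr2.2.le⟩
      exact (hasDerivWithinAt_const s (Ici s) (G s)).congr_of_eventuallyEq h1 rfl
  have e1 : (J.filter fun x => x ≤ T) = J := Finset.filter_true_of_mem hJT
  have e2 : (J.filter fun x => x ≤ t) = ∅ := by
    rw [Finset.filter_eq_empty_iff]
    intro x hx
    exact not_le.2 (hJt x hx)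
  simp only [hG, e1, e2, intervalIntegral.integral_same, Finset.sum_empty] at hconst
  linarith

/-! ### Sums over jump times. -/

namespace IsCountingPath

variable {t : ℝ} {n : ℝ → ℕ}

/-- The jump times of a counting path in `(t, T]`. -/
noncomputable def jumpTimes (h : IsCountingPath t n) (T : ℝ) : Finset ℝ :=
  (h.finite_jumps T).toFinset

lemma mem_jumpTimes (h : IsCountingPath t n) {T s : ℝ} :
    s ∈ h.jumpTimes T ↔ s ∈ Ioc t T ∧ jumpAt n s ≠ 0 := by
  simp [jumpTimes]

lemma tsum_jump (h : IsCountingPath t n) (T : ℝ) (f : ℝ → ℝ≥0∞) :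
    ∑' s : Ioc t T, f s * (jumpAt n s : ℝ≥0∞) =
      ∑ s ∈ h.jumpTimes T, f s * (jumpAt n s : ℝ≥0∞) := by
  rw [tsum_subtype (Ioc t T) (fun s => f s * (jumpAt n s : ℝ≥0∞)),
    tsum_eq_sum (s := h.jumpTimes T)]
  · refine Finset.sum_congr rfl fun s hs => ?_
    rw [indicator_of_mem (h.mem_jumpTimes.1 hs).1]
  · intro s hs
    rw [h.mem_jumpTimes, not_and_or, not_not] at hs
    rcases hs with hs | hs
    · exact indicator_of_notMem hs _
    · by_cases h' : s ∈ Ioc t T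
      · simp [indicator_of_mem h', hs]
      · exact indicator_of_notMem h' _

/-- The change formula for the path `n` itself, with the identity as test function and zero time
derivative. -/
lemma sum_jump (h : IsCountingPath t n) {a T : ℝ} (ha : t ≤ a) (haT : a ≤ T) :
    ∑ s ∈ h.jumpTimes T with a < s, (jumpAt n s : ℝ) = n T - n a := by
  have key := sub_eq_integral_add_sum_jumps (E := ℕ) haT (p := n) (pL := Function.leftLim n)
    h.eventually_right h.eventually_left ((h.jumpTimes T).filter fun s => a < s)
    (fun s hs hsJ => ?_) (fun s hs => (Finset.mem_filter.1 hs).2)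
    (fun s hs => (h.mem_jumpTimes.1 (Finset.mem_filter.1 hs).1).1.2)
    (fun _ e => (e : ℝ)) (fun _ _ => 0) (by simp) (by simp)
  · rw [key]
    simp only [intervalIntegral.integral_zero, zero_add]
    refine Finset.sum_congr rfl fun s _ => ?_
    rw [← h.leftLim_add_jumpAt s]
    push_cast
    ring
  · have h1 : jumpAt n s = 0 := by
      by_contra h2
      exact hsJ (Finset.mem_filter.2 ⟨h.mem_jumpTimes.2 ⟨⟨ha.trans_lt hs.1, hs.2⟩, h2⟩, hs.1⟩)
    have := h.leftLim_add_jumpAt s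
    omega

end IsCountingPath

/-! ### Predictability and the compensation formula. -/

section Predictable

variable {Ω : Type} {mΩ : MeasurableSpace Ω} {𝓕 : Filtration ℝ mΩ}

lemma predictableσ_le : predictableσ 𝓕 ≤ Prod.instMeasurableSpace := by
  refine MeasurableSpace.generateFrom_le ?_
  rintro _ ⟨u, A, hA, rfl⟩
  exact measurableSet_Ioi.prod (𝓕.le u _ hA)

lemma measurableSet_predictableσ (u : ℝ) {A : Set Ω} (hA : MeasurableSet[𝓕 u] A) :
    MeasurableSet[predictableσ 𝓕] (Ioi u ×ˢ A) :=
  MeasurableSpace.measurableSet_generateFrom ⟨u, A, hA, rfl⟩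

lemma measurable_fst_predictableσ :
    Measurable[predictableσ 𝓕] (Prod.fst : ℝ × Ω → ℝ) := by
  refine @measurable_of_Ioi _ _ _ _ _ (predictableσ 𝓕) _ _ _ _ fun u => ?_
  have := measurableSet_predictableσ (𝓕 := 𝓕) u (A := univ) MeasurableSet.univ
  convert this using 1
  ext z
  simp

variable {N : ℝ → Ω → ℕ} {t T : ℝ}

lemma measurable_leftLim_predictableσ (hN : ∀ s, Measurable[𝓕 s] (N s))
    (hc : ∀ ω, IsCountingPath t fun s => N s ω) :
    Measurable[predictableσ 𝓕]
      (fun z : ℝ × Ω => Function.leftLim (fun r => N r z.2) z.1) := by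
  refine @measurable_of_Ici _ _ _ _ _ (predictableσ 𝓕) _ _ _ _ fun k => ?_
  have : (fun z : ℝ × Ω => Function.leftLim (fun r => N r z.2) z.1) ⁻¹' Ici k =
      ⋃ r : ℚ, Ioi (r : ℝ) ×ˢ (N r ⁻¹' Ici k) := by
    ext z
    simp only [mem_preimage, mem_Ici, mem_iUnion, mem_prod, mem_Ioi]
    exact (hc z.2).le_leftLim_iff z.1 k
  rw [this]
  exact MeasurableSet.iUnion fun r => measurableSet_predictableσ _ (hN r measurableSet_Ici)

lemma measurable_uncurry_counting (hN : ∀ s, Measurable (N s))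
    (hc : ∀ ω, IsCountingPath t fun s => N s ω) :
    Measurable (fun z : ℝ × Ω => N z.1 z.2) := by
  refine measurable_of_Iio fun k => ?_
  have : (fun z : ℝ × Ω => N z.1 z.2) ⁻¹' Iio k =
      ⋃ r : ℚ, Iio (r : ℝ) ×ˢ (N r ⁻¹' Iio k) := by
    ext z
    simp only [mem_preimage, mem_Iio, mem_iUnion, mem_prod]
    exact (hc z.2).lt_iff z.1 k
  rw [this]
  exact MeasurableSet.iUnion fun r => measurableSet_Iio.prod (hN r measurableSet_Iio)

/-- A π-λ argument. On a generator `(u, ∞) × A` the sum is an increment of `N` restricted to `A`;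
complements are handled by subtracting from the finite total `N T`. Simple functions and monotone
limits follow. -/
lemma measurable_tsum_jump (hN : ∀ s, Measurable[𝓕 s] (N s))
    (hc : ∀ ω, IsCountingPath t fun s => N s ω) (htT : t ≤ T) {C : ℝ × Ω → ℝ≥0∞}
    (hC : Measurable[predictableσ 𝓕] C) :
    Measurable fun ω =>
      ∑' s : Ioc t T, C (s, ω) * (jumpAt (fun r => N r ω) s : ℝ≥0∞) := by
  have hNm : ∀ s, Measurable (N s) := fun s => (hN s).mono (𝓕.le s) le_rfl
  have key : ∀ B : Set (ℝ × Ω), MeasurableSet[predictableσ 𝓕] B → Measurable fun ω =>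
      ∑' s : Ioc t T, B.indicator 1 ((s : ℝ), ω) * (jumpAt (fun r => N r ω) s : ℝ≥0∞) := by
    have htot : ∀ ω a, t ≤ a → a ≤ T → ∑' s : Ioc t T, (Ioi a).indicator 1 (s : ℝ) *
        (jumpAt (fun r => N r ω) s : ℝ≥0∞) = ((N T ω - N a ω : ℕ) : ℝ≥0∞) := by
      intro ω a hta haT
      have h := (hc ω).sum_jump hta haT
      rw [(hc ω).tsum_jump]
      have h1 : ∑ s ∈ (hc ω).jumpTimes T, (Ioi a).indicator (1 : ℝ → ℝ≥0∞) s *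
          (jumpAt (fun r => N r ω) s : ℝ≥0∞) =
          ((∑ s ∈ (hc ω).jumpTimes T with a < s, jumpAt (fun r => N r ω) s : ℕ) : ℝ≥0∞) := by
        rw [Finset.sum_filter]
        push_cast
        refine Finset.sum_congr rfl fun s _ => ?_
        by_cases hs : a < s <;> simp [indicator, hs]
      rw [h1]
      congr 1
      have h2 : N a ω ≤ N T ω := (hc ω).mono haT
      rw [← Nat.cast_inj (R := ℝ), Nat.cast_sub h2]
      push_cast
      exact h
    have htot' : ∀ ω, ∑' s : Ioc t T, (jumpAt (fun r => N r ω) s : ℝ≥0∞) =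
        (N T ω : ℝ≥0∞) := by
      intro ω
      have := htot ω t le_rfl htT
      rw [(hc ω).start t le_rfl, Nat.sub_zero] at this
      rw [← this]
      refine tsum_congr fun s => ?_
      rw [indicator_of_mem (show (s : ℝ) ∈ Ioi t from s.2.1)]
      simp
    refine MeasurableSpace.induction_on_inter (m := predictableσ 𝓕) rfl ?_ ?_ ?_ ?_ ?_
    · rintro _ ⟨u, A, hA, rfl⟩ _ ⟨u', A', hA', rfl⟩ _
      refine ⟨max u u', A ∩ A', ?_, ?_⟩
      · exact MeasurableSet.inter (𝓕.mono (le_max_left u u') _ hA)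
          (𝓕.mono (le_max_right u u') _ hA')
      · rw [prod_inter_prod, Ioi_inter_Ioi]
    · simp
    · rintro _ ⟨u, A, hA, rfl⟩
      have hA' := 𝓕.le u _ hA
      have : (fun ω => ∑' s : Ioc t T, (Ioi u ×ˢ A).indicator 1 ((s : ℝ), ω) *
          (jumpAt (fun r => N r ω) s : ℝ≥0∞)) =
          -- The time `u` is arbitrary, so it is clamped to `[t, T]`; this does not change which
          -- jumps in `(t, T]` are counted.
          A.indicator fun ω => ((N T ω - N (min T (max u t)) ω : ℕ) : ℝ≥0∞) := by
        ext ω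
        by_cases hω : ω ∈ A
        · rw [indicator_of_mem hω, ← htot ω _ (le_min htT (le_max_right _ _)) (min_le_left _ _)]
          refine tsum_congr fun s => ?_
          congr 1
          have hiff : (s : ℝ) ∈ Ioi u ↔ (s : ℝ) ∈ Ioi (min T (max u t)) := by
            simp only [mem_Ioi, min_lt_iff, max_lt_iff]
            constructor
            · intro h
              exact Or.inr ⟨h, s.2.1⟩
            · rintro (h | h)
              · exact absurd h (not_lt.2 s.2.2)
              · exact h.1
          by_cases hs : (s : ℝ) ∈ Ioi u
          · rw [indicator_of_mem (hiff.1 hs), indicator_of_mem (mk_mem_prod hs hω)]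
            rfl
          · rw [indicator_of_notMem (fun h => hs (hiff.2 h)),
              indicator_of_notMem (fun h => hs h.1)]
        · rw [indicator_of_notMem hω, ENNReal.tsum_eq_zero]
          intro s
          rw [indicator_of_notMem (fun h => hω h.2), zero_mul]
      rw [this]
      refine Measurable.indicator ?_ hA'
      exact measurable_from_nat.comp ((hNm T).sub (hNm _))
    · intro B _ hB
      have : (fun ω => ∑' s : Ioc t T, Bᶜ.indicator 1 ((s : ℝ), ω) *
          (jumpAt (fun r => N r ω) s : ℝ≥0∞)) = fun ω => (N T ω : ℝ≥0∞) -
          ∑' s : Ioc t T, B.indicator 1 ((s : ℝ), ω) *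
          (jumpAt (fun r => N r ω) s : ℝ≥0∞) := by
        ext ω
        have hle : ∑' s : Ioc t T, B.indicator 1 ((s : ℝ), ω) *
            (jumpAt (fun r => N r ω) s : ℝ≥0∞) ≤ N T ω := by
          rw [← htot' ω]
          refine ENNReal.tsum_le_tsum fun s => ?_
          by_cases h : ((s : ℝ), ω) ∈ B <;> simp [h]
        refine ENNReal.eq_sub_of_add_eq (ne_top_of_le_ne_top (ENNReal.natCast_ne_top _) hle) ?_
        rw [← ENNReal.tsum_add, ← htot' ω]
        refine tsum_congr fun s => ?_
        by_cases h : ((s : ℝ), ω) ∈ B <;> simp [h]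
      rw [this]
      exact (measurable_from_nat.comp (hNm T)).sub hB
    · intro B hd _ hB
      have : (fun ω => ∑' s : Ioc t T, (⋃ i, B i).indicator 1 ((s : ℝ), ω) *
          (jumpAt (fun r => N r ω) s : ℝ≥0∞)) = fun ω => ∑' i,
          ∑' s : Ioc t T, (B i).indicator 1 ((s : ℝ), ω) *
          (jumpAt (fun r => N r ω) s : ℝ≥0∞) := by
        ext ω
        rw [ENNReal.tsum_comm]
        refine tsum_congr fun s => ?_
        rw [ENNReal.tsum_mul_right]
        congr 1
        by_cases h : ((s : ℝ), ω) ∈ ⋃ i, B i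
        · obtain ⟨i, hi⟩ := mem_iUnion.1 h
          rw [indicator_of_mem h, tsum_eq_single i, indicator_of_mem hi]
          intro j hj
          exact indicator_of_notMem (fun h' => disjoint_left.1 (hd hj) h' hi) _
        · rw [indicator_of_notMem h, eq_comm, ENNReal.tsum_eq_zero]
          intro i
          exact indicator_of_notMem (fun h' => h (mem_iUnion.2 ⟨i, h'⟩)) _
      rw [this]
      exact Measurable.tsum hB
  refine @Measurable.ennreal_induction _ (predictableσ 𝓕) (fun C => Measurable fun ω =>
      ∑' s : Ioc t T, C (s, ω) * (jumpAt (fun r => N r ω) s : ℝ≥0∞)) ?_ ?_ ?_ C hC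
  · intro c B hB
    have : (fun ω => ∑' s : Ioc t T, B.indicator (fun _ => c) ((s : ℝ), ω) *
        (jumpAt (fun r => N r ω) s : ℝ≥0∞)) = fun ω => c *
        ∑' s : Ioc t T, B.indicator 1 ((s : ℝ), ω) * (jumpAt (fun r => N r ω) s : ℝ≥0∞) := by
      ext ω
      rw [← ENNReal.tsum_mul_left]
      refine tsum_congr fun s => ?_
      by_cases h : ((s : ℝ), ω) ∈ B <;> simp [h]
    rw [this]
    exact (key B hB).const_mul c
  · intro f g _ _ _ hf hg
    simp only [Pi.add_apply, add_mul, ENNReal.tsum_add]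
    exact hf.add hg
  · intro f _ hmono hf
    have : (fun ω => ∑' s : Ioc t T, (⨆ i, f i ((s : ℝ), ω)) *
        (jumpAt (fun r => N r ω) s : ℝ≥0∞)) = fun ω => ⨆ i,
        ∑' s : Ioc t T, f i ((s : ℝ), ω) * (jumpAt (fun r => N r ω) s : ℝ≥0∞) := by
      ext ω
      rw [(hc ω).tsum_jump T (fun s => ⨆ i, f i (s, ω))]
      simp only [fun i => (hc ω).tsum_jump T (fun s => f i (s, ω)), ENNReal.iSup_mul]
      refine ENNReal.finsetSum_iSup_of_monotone fun s i j hij => ?_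
      have := hmono hij (s, ω)
      gcongr
    rw [this]
    exact Measurable.iSup hf

/-- The compensation formula for bounded predictable integrands. -/
lemma HasIntensity.integral_sum_jump {P : Measure Ω} [IsProbabilityMeasure P]
    {lam : ℝ → Ω → ℝ} (hI : HasIntensity P 𝓕 t T N lam)
    (hN : ∀ s, Measurable[𝓕 s] (N s)) (hc : ∀ ω, IsCountingPath t fun s => N s ω) (htT : t ≤ T)
    (hlm : Measurable (Function.uncurry lam)) (hl0 : ∀ s ω, 0 ≤ lam s ω)
    {B : ℝ} (hlB : ∀ s ω, lam s ω ≤ B) {c : ℝ → Ω → ℝ}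
    (hcm : Measurable[predictableσ 𝓕] (Function.uncurry c)) {K : ℝ}
    (hcK : ∀ s ∈ Ioc t T, ∀ ω, |c s ω| ≤ K) :
    Integrable (fun ω => ∑ s ∈ (hc ω).jumpTimes T, c s ω * (jumpAt (fun r => N r ω) s : ℝ)) P ∧
    ∫ ω, ∑ s ∈ (hc ω).jumpTimes T, c s ω * (jumpAt (fun r => N r ω) s : ℝ) ∂P =
      ∫ z, c z.1 z.2 * lam z.1 z.2 ∂((volume.restrict (Ioc t T)).prod P) := by
  set π := (volume.restrict (Ioc t T)).prod P with hπ
  have hcm' : Measurable (Function.uncurry c) := hcm.mono predictableσ_le le_rfl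
  have hae : ∀ᵐ z ∂π, z.1 ∈ Ioc t T := by
    have h1 : ∀ᵐ s ∂(volume.restrict (Ioc t T)), s ∈ Ioc t T :=
      ae_restrict_mem measurableSet_Ioc
    exact Measure.quasiMeasurePreserving_fst.ae h1
  -- The defining property of the intensity concerns nonnegative integrands. It is applied to the
  -- positive parts of `c` and `-c`, each with finite total because `f` and `lam` are bounded.
  have hpart : ∀ f : ℝ → Ω → ℝ, Measurable[predictableσ 𝓕] (Function.uncurry f) →
      (∀ s ∈ Ioc t T, ∀ ω, |f s ω| ≤ K) →
      ∃ A : Ω → ℝ≥0∞, Measurable A ∧ (∀ ω, A ω = ∑ s ∈ (hc ω).jumpTimes T,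
        ENNReal.ofReal (f s ω) * (jumpAt (fun r => N r ω) s : ℝ≥0∞)) ∧
        ∫⁻ ω, A ω ∂P = ∫⁻ z, ENNReal.ofReal (f z.1 z.2 * lam z.1 z.2) ∂π ∧
        ∫⁻ ω, A ω ∂P ≠ ∞ := by
    intro f hf hfK
    have hf' : Measurable (Function.uncurry f) := hf.mono predictableσ_le le_rfl
    have hof : Measurable[predictableσ 𝓕] fun z : ℝ × Ω => ENNReal.ofReal (f z.1 z.2) :=
      ENNReal.measurable_ofReal.comp hf
    have hint : ∫⁻ ω, (∑' s : Ioc t T, ENNReal.ofReal (f s ω) *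
        (jumpAt (fun r => N r ω) s : ℝ≥0∞)) ∂P =
        ∫⁻ z, ENNReal.ofReal (f z.1 z.2 * lam z.1 z.2) ∂π := by
      rw [hI (fun s ω => ENNReal.ofReal (f s ω)) hof, hπ, lintegral_prod_symm]
      · refine lintegral_congr fun ω => lintegral_congr fun s => ?_
        rw [ENNReal.ofReal_mul' (hl0 s ω)]
      · exact (ENNReal.measurable_ofReal.comp (hf'.mul hlm)).aemeasurable
    refine ⟨fun ω => ∑' s : Ioc t T, ENNReal.ofReal (f s ω) *
        (jumpAt (fun r => N r ω) s : ℝ≥0∞), measurable_tsum_jump hN hc htT hof, ?_, hint, ?_⟩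
    · intro ω
      exact (hc ω).tsum_jump T fun s => ENNReal.ofReal (f s ω)
    · rw [hint]
      have hb : ∫⁻ z, ENNReal.ofReal (f z.1 z.2 * lam z.1 z.2) ∂π ≤
          ∫⁻ _, ENNReal.ofReal (K * B) ∂π := by
        refine lintegral_mono_ae ?_
        filter_upwards [hae] with z hz
        refine ENNReal.ofReal_le_ofReal ?_
        have h1 := hfK z.1 hz z.2
        exact mul_le_mul ((le_abs_self _).trans h1) (hlB _ _) (hl0 _ _)
          ((abs_nonneg _).trans h1)
      refine ne_top_of_le_ne_top ?_ hb
      rw [lintegral_const]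
      exact ENNReal.mul_ne_top ENNReal.ofReal_ne_top (measure_ne_top _ _)
  obtain ⟨A, hA, hAs, hAi, hAf⟩ := hpart c hcm hcK
  obtain ⟨A', hA', hAs', hAi', hAf'⟩ := hpart (fun s ω => - c s ω) hcm.neg
    (by simpa using hcK)
  have hsum : (fun ω => ∑ s ∈ (hc ω).jumpTimes T, c s ω * (jumpAt (fun r => N r ω) s : ℝ)) =
      fun ω => (A ω).toReal - (A' ω).toReal := by
    ext ω
    rw [hAs, hAs', ENNReal.toReal_sum, ENNReal.toReal_sum, ← Finset.sum_sub_distrib]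
    · refine Finset.sum_congr rfl fun s _ => ?_
      simp only [ENNReal.toReal_mul, ENNReal.toReal_natCast, ENNReal.toReal_ofReal']
      rw [← sub_mul]
      congr 1
      rcases le_total (c s ω) 0 with h | h
      · rw [max_eq_right h, max_eq_left (by linarith)]; ring
      · rw [max_eq_left h, max_eq_right (by linarith)]; ring
    · intro s _
      exact ENNReal.mul_ne_top ENNReal.ofReal_ne_top (ENNReal.natCast_ne_top _)
    · intro s _
      exact ENNReal.mul_ne_top ENNReal.ofReal_ne_top (ENNReal.natCast_ne_top _)
  have hiA := integrable_toReal_of_lintegral_ne_top hA.aemeasurable hAf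
  have hiA' := integrable_toReal_of_lintegral_ne_top hA'.aemeasurable hAf'
  rw [hsum]
  refine ⟨hiA.sub hiA', ?_⟩
  have hprod : Integrable (fun z => c z.1 z.2 * lam z.1 z.2) π := by
    refine Integrable.of_bound (hcm'.mul hlm).aestronglyMeasurable (K * B) ?_
    filter_upwards [hae] with z hz
    have h1 := hcK z.1 hz z.2
    rw [Real.norm_eq_abs, abs_mul, abs_of_nonneg (hl0 z.1 z.2)]
    exact mul_le_mul h1 (hlB _ _) (hl0 _ _) ((abs_nonneg _).trans h1)
  rw [integral_sub hiA hiA', integral_toReal hA.aemeasurable (ae_lt_top hA hAf),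
    integral_toReal hA'.aemeasurable (ae_lt_top hA' hAf'), hAi, hAi',
    integral_eq_lintegral_pos_part_sub_lintegral_neg_part hprod]
  simp only [neg_mul]

end Predictable

attribute [instance] ControlledSystem.mΩ ControlledSystem.isProbability

/-! ### Fill counts and the inventories they lead to. -/

/-- One fill on side `k` of asset `j`. -/
def oneFill {d : ℕ} (j : Fin d) (k : Side) : Fin d → Side → ℕ := Pi.single j (Pi.single k 1)

lemma oneFill_apply {d : ℕ} (j j' : Fin d) (k k' : Side) :
    oneFill j k j' k' = if j' = j ∧ k' = k then 1 else 0 := by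
  by_cases hj : j' = j
  · subst hj
    by_cases hk : k' = k
    · subst hk
      simp [oneFill]
    · simp [oneFill, hk]
  · simp [oneFill, hj]

namespace Market

variable {d : ℕ} (M : Market d)

lemma inventory_zero (q : Fin d → ℝ) : M.inventory q 0 = q := by
  ext j
  simp [inventory]

lemma inventory_add_oneFill (q : Fin d → ℝ) (n : Fin d → Side → ℕ) (j : Fin d) (k : Side) :
    M.inventory q (n + oneFill j k) = M.shift (M.inventory q n) j k := by
  ext i
  by_cases hi : i = j
  · subst hi
    cases k <;> simp [inventory, shift, oneFill_apply, Side.sign] <;> ring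
  · simp [inventory, shift, oneFill_apply, hi]

lemma shift_mem_inventories {q : Fin d → ℝ} (hq : q ∈ M.inventories) {j : Fin d} {k : Side}
    (h : q j + k.sign * M.m j ∈ M.levels j) : M.shift q j k ∈ M.inventories := by
  intro i
  by_cases hi : i = j
  · subst hi
    simpa [shift] using h
  · simpa [shift, hi] using hq i

lemma room_of_mem {q : Fin d → ℝ} {j : Fin d} {k : Side}
    (h : q j + k.sign * M.m j ∈ M.levels j) : M.room q j k = 1 := indicator_of_mem h _

lemma room_of_notMem {q : Fin d → ℝ} {j : Fin d} {k : Side}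
    (h : q j + k.sign * M.m j ∉ M.levels j) : M.room q j k = 0 := indicator_of_notMem h _

lemma room_nonneg (q : Fin d → ℝ) (j : Fin d) (k : Side) : 0 ≤ M.room q j k :=
  indicator_nonneg (fun _ _ => zero_le_one) _

lemma room_le_one (q : Fin d → ℝ) (j : Fin d) (k : Side) : M.room q j k ≤ 1 :=
  indicator_le' (fun _ _ => le_rfl) (fun _ _ => zero_le_one) _

lemma finite_levels (j : Fin d) : (M.levels j).Finite := by
  refine ((finite_Iic (⌊2 * M.Q j / M.m j⌋₊)).image fun i : ℕ => -M.Q j + i * M.m j).subset ?_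
  rintro x ⟨i, rfl, hx⟩
  refine ⟨i, ?_, rfl⟩
  rw [mem_Iic]
  apply Nat.le_floor
  rw [le_div_iff₀ (M.m_pos j)]
  linarith

lemma finite_inventories : M.inventories.Finite :=
  Set.Finite.pi' fun j => M.finite_levels j

end Market

/-! ### Dynkin's formula for a controlled system. -/

namespace ControlledSystem

variable {d : ℕ} {M : Market d} {t : ℝ} {q : Fin d → ℝ} (S : ControlledSystem M t q)

/-- The numbers of fills up to time `s`. -/
def fills (s : ℝ) (ω : S.Ω) : Fin d → Side → ℕ := fun j k => S.N j k s ω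

/-- The numbers of fills before time `s`. -/
noncomputable def fillsLeft (s : ℝ) (ω : S.Ω) : Fin d → Side → ℕ :=
  fun j k => Function.leftLim (fun r => S.N j k r ω) s

/-- The fill intensities. -/
noncomputable def rate (j : Fin d) (k : Side) (s : ℝ) (ω : S.Ω) : ℝ :=
  S.l j k s ω * M.Λ j k * M.room (S.inv s ω) j k

lemma inv_eq (s : ℝ) (ω : S.Ω) : S.inv s ω = M.inventory q (S.fills s ω) := rfl

lemma invLeft_eq (s : ℝ) (ω : S.Ω) : S.invLeft s ω = M.inventory q (S.fillsLeft s ω) := rfl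

lemma eventually_fills_right (ω : S.Ω) (s : ℝ) :
    ∀ᶠ r in 𝓝[≥] s, S.fills r ω = S.fills s ω := by
  have : ∀ᶠ r in 𝓝[≥] s, ∀ j k, S.N j k r ω = S.N j k s ω :=
    eventually_all.2 fun j => eventually_all.2 fun k => (S.counting j k ω).eventually_right s
  filter_upwards [this] with r hr
  ext j k
  exact hr j k

lemma eventually_fills_left (ω : S.Ω) (s : ℝ) :
    ∀ᶠ r in 𝓝[<] s, S.fills r ω = S.fillsLeft s ω := by
  have : ∀ᶠ r in 𝓝[<] s, ∀ j k, S.N j k r ω = Function.leftLim (fun r => S.N j k r ω) s :=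
    eventually_all.2 fun j => eventually_all.2 fun k => (S.counting j k ω).eventually_left s
  filter_upwards [this] with r hr
  ext j k
  exact hr j k

/-- The jump times of all the counting processes in `(t, T]`. -/
noncomputable def jumpTimes (ω : S.Ω) : Finset ℝ :=
  Finset.univ.biUnion fun j => Finset.univ.biUnion fun k => (S.counting j k ω).jumpTimes M.T

lemma mem_jumpTimes {ω : S.Ω} {s : ℝ} : s ∈ S.jumpTimes ω ↔
    s ∈ Ioc t M.T ∧ ∃ j k, jumpAt (fun r => S.N j k r ω) s ≠ 0 := by
  simp only [jumpTimes, Finset.mem_biUnion, Finset.mem_univ, true_and,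
    IsCountingPath.mem_jumpTimes]
  constructor
  · rintro ⟨j, k, h, h'⟩
    exact ⟨h, j, k, h'⟩
  · rintro ⟨h, j, k, h'⟩
    exact ⟨j, k, h, h'⟩

lemma fills_eq_fillsLeft {ω : S.Ω} {s : ℝ} (hs : s ∈ Ioc t M.T) (h : s ∉ S.jumpTimes ω) :
    S.fills s ω = S.fillsLeft s ω := by
  ext j k
  have h1 := (S.counting j k ω).leftLim_add_jumpAt s
  have h2 : jumpAt (fun r => S.N j k r ω) s = 0 := by
    by_contra h2
    exact h (S.mem_jumpTimes.2 ⟨hs, j, k, h2⟩)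
  simp only [fills, fillsLeft]
  omega

/-- Jumps are of size one and never simultaneous, so at most one term of the double sum is nonzero.
-/
lemma jump_eq_sum (f : (Fin d → Side → ℕ) → ℝ) (ω : S.Ω) (s : ℝ) :
    f (S.fills s ω) - f (S.fillsLeft s ω) =
      ∑ j, ∑ k, (f (S.fillsLeft s ω + oneFill j k) - f (S.fillsLeft s ω)) *
        (jumpAt (fun r => S.N j k r ω) s : ℝ) := by
  by_cases h : ∃ j k, jumpAt (fun r => S.N j k r ω) s ≠ 0
  · obtain ⟨j, k, hjk⟩ := h
    have h0 : ∀ j' k', ¬ (j' = j ∧ k' = k) → jumpAt (fun r => S.N j' k' r ω) s = 0 := by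
      intro j' k' hne
      by_contra h'
      exact hne (S.no_common_jumps ω s j' k' j k h' hjk)
    have h1 : jumpAt (fun r => S.N j k r ω) s = 1 := by
      have := (S.counting j k ω).jumpAt_le_one s
      omega
    have h2 : S.fills s ω = S.fillsLeft s ω + oneFill j k := by
      ext j' k'
      have h3 := (S.counting j' k' ω).leftLim_add_jumpAt s
      simp only [fills, fillsLeft, Pi.add_apply, oneFill_apply]
      split_ifs with h4
      · obtain ⟨rfl, rfl⟩ := h4
        omega
      · have := h0 j' k' h4
        omega
    rw [Finset.sum_eq_single j, Finset.sum_eq_single k, h1, h2]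
    · simp
    · intro k' _ hk'
      simp [h0 j k' fun h => hk' h.2]
    · simp
    · intro j' _ hj'
      refine Finset.sum_eq_zero fun k' _ => ?_
      simp [h0 j' k' fun h => hj' h.1]
    · simp
  · push Not at h
    have h2 : S.fills s ω = S.fillsLeft s ω := by
      ext j k
      have h3 := (S.counting j k ω).leftLim_add_jumpAt s
      have := h j k
      simp only [fills, fillsLeft]
      omega
    simp [h, h2]

lemma measurable_fillsLeft :
    Measurable[predictableσ S.𝓕] fun z : ℝ × S.Ω => S.fillsLeft z.1 z.2 := by
  refine @measurable_pi_lambda _ _ _ (predictableσ S.𝓕) _ _ fun j =>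
    @measurable_pi_lambda _ _ _ (predictableσ S.𝓕) _ _ fun k => ?_
  exact measurable_leftLim_predictableσ (S.adapted j k) (S.counting j k)

lemma measurable_N (j : Fin d) (k : Side) (s : ℝ) : Measurable (S.N j k s) :=
  (S.adapted j k s).mono (S.𝓕.le s) le_rfl

lemma measurable_fills : Measurable fun z : ℝ × S.Ω => S.fills z.1 z.2 :=
  measurable_pi_lambda _ fun j => measurable_pi_lambda _ fun k =>
    measurable_uncurry_counting (S.measurable_N j k) (S.counting j k)

lemma measurable_l (j : Fin d) (k : Side) : Measurable (Function.uncurry (S.l j k)) :=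
  (S.control_predictable j k).mono predictableσ_le le_rfl

/-- Time and randomness on `(t, T]`. -/
noncomputable def timeMeasure : Measure (ℝ × S.Ω) := (volume.restrict (Ioc t M.T)).prod S.P

instance : IsFiniteMeasure S.timeMeasure := by
  unfold timeMeasure
  infer_instance

lemma ae_timeMeasure_mem : ∀ᵐ z ∂S.timeMeasure, z.1 ∈ Ioc t M.T := by
  have h1 : ∀ᵐ s ∂(volume.restrict (Ioc t M.T)), s ∈ Ioc t M.T :=
    ae_restrict_mem measurableSet_Ioc
  exact Measure.quasiMeasurePreserving_fst.ae h1

lemma ae_timeMeasure_of_ae_ae {p : ℝ × S.Ω → Prop} (hp : MeasurableSet {z | p z})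
    (h : ∀ ω, ∀ᵐ s ∂volume.restrict (Ioc t M.T), p (s, ω)) : ∀ᵐ z ∂S.timeMeasure, p z := by
  have h1 : ∀ᵐ z ∂(S.P.prod (volume.restrict (Ioc t M.T))), p z.swap := by
    exact (Measure.ae_prod_mem_iff_ae_ae_mem (measurable_swap hp)).2 (Eventually.of_forall h)
  rw [timeMeasure, ← Measure.prod_swap, ae_map_iff measurable_swap.aemeasurable hp]
  exact h1

lemma ae_fills_eq_fillsLeft_of_path (ω : S.Ω) :
    ∀ᵐ s ∂volume.restrict (Ioc t M.T), S.fills s ω = S.fillsLeft s ω := by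
  have h1 : ∀ᵐ s ∂(volume : Measure ℝ), s ∉ S.jumpTimes ω := by
    rw [ae_iff]
    simp only [not_not]
    exact (S.jumpTimes ω).finite_toSet.measure_zero _
  filter_upwards [ae_restrict_mem measurableSet_Ioc, ae_restrict_of_ae h1] with s hs hs'
  exact S.fills_eq_fillsLeft hs hs'

/-- Each path has finitely many jump times, a null set in time. Inside time integrals one may
therefore pass between the left limits, which are predictable, and the current values, which enter
the intensities and the payoff. -/
lemma ae_fills_eq_fillsLeft :
    ∀ᵐ z ∂S.timeMeasure, S.fills z.1 z.2 = S.fillsLeft z.1 z.2 :=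
  S.ae_timeMeasure_of_ae_ae
    (measurableSet_eq_fun S.measurable_fills (S.measurable_fillsLeft.mono predictableσ_le le_rfl))
    S.ae_fills_eq_fillsLeft_of_path

/-- Fill counts range over a countable type, so measurability in time for each fixed count is
enough. -/
lemma measurable_comp_fills {g : ℝ → (Fin d → Side → ℕ) → ℝ} (hg : ∀ n, Measurable fun s => g s n) :
    Measurable fun z : ℝ × S.Ω => g z.1 (S.fills z.1 z.2) :=
  (measurable_from_prod_countable_left (f := fun x : ℝ × (Fin d → Side → ℕ) => g x.1 x.2) hg).comp
    (measurable_fst.prodMk S.measurable_fills)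

lemma measurable_comp_fillsLeft {g : ℝ → (Fin d → Side → ℕ) → ℝ}
    (hg : ∀ n, Measurable fun s => g s n) :
    Measurable[predictableσ S.𝓕] fun z : ℝ × S.Ω => g z.1 (S.fillsLeft z.1 z.2) :=
  (measurable_from_prod_countable_left (f := fun x : ℝ × (Fin d → Side → ℕ) => g x.1 x.2) hg).comp
    (measurable_fst_predictableσ.prodMk S.measurable_fillsLeft)

lemma measurable_rate (j : Fin d) (k : Side) : Measurable (Function.uncurry (S.rate j k)) :=
  ((S.measurable_l j k).mul_const _).mul
    (S.measurable_comp_fills (g := fun _ n => M.room (M.inventory q n) j k)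
      fun _ => measurable_const)

lemma rate_nonneg (j : Fin d) (k : Side) (s : ℝ) (ω : S.Ω) : 0 ≤ S.rate j k s ω := by
  have := M.Λ_nonneg j k
  have := M.room_nonneg (S.inv s ω) j k
  rcases S.control_mem j k s ω with h | h <;> simp only [rate, h] <;> positivity

lemma rate_le (j : Fin d) (k : Side) (s : ℝ) (ω : S.Ω) : S.rate j k s ω ≤ M.Λ j k := by
  have h0 := M.Λ_nonneg j k
  have h1 := M.room_le_one (S.inv s ω) j k
  have h2 := mul_le_mul_of_nonneg_left h1 h0
  rcases S.control_mem j k s ω with h | h <;> simp only [rate, h] <;> linarith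

/-- Dynkin's formula for the fill counts. -/
lemma dynkin (htT : t ≤ M.T) {w w' : ℝ → (Fin d → Side → ℕ) → ℝ}
    (hwm : ∀ n, Measurable fun s => w s n) (hwm' : ∀ n, Measurable fun s => w' s n) {K : ℝ}
    (hK : ∀ s ∈ Icc t M.T, ∀ n, |w s n| ≤ K) (hK' : ∀ s ∈ Icc t M.T, ∀ n, |w' s n| ≤ K)
    (hw : ∀ n, ∀ a ∈ Icc t M.T, ∀ b ∈ Icc t M.T, a ≤ b →
      ∫ r in a..b, w' r n = w b n - w a n) :
    Integrable (fun z => w' z.1 (S.fills z.1 z.2) + ∑ j, ∑ k,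
      (w z.1 (S.fills z.1 z.2 + oneFill j k) - w z.1 (S.fills z.1 z.2)) *
        S.rate j k z.1 z.2) S.timeMeasure ∧
    ∫ ω, w M.T (S.fills M.T ω) ∂S.P - w t 0 = ∫ z, (w' z.1 (S.fills z.1 z.2) + ∑ j, ∑ k,
      (w z.1 (S.fills z.1 z.2 + oneFill j k) - w z.1 (S.fills z.1 z.2)) *
        S.rate j k z.1 z.2) ∂S.timeMeasure := by
  -- The increments are evaluated at the left limits, since the compensation formula requires
  -- predictable integrands.
  set c : Fin d → Side → ℝ → S.Ω → ℝ := fun j k s ω =>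
    w s (S.fillsLeft s ω + oneFill j k) - w s (S.fillsLeft s ω) with hc
  have hcm : ∀ j k, Measurable[predictableσ S.𝓕] (Function.uncurry (c j k)) := fun j k =>
    S.measurable_comp_fillsLeft (g := fun s n => w s (n + oneFill j k) - w s n)
      fun n => (hwm _).sub (hwm _)
  have hcK : ∀ j k, ∀ s ∈ Ioc t M.T, ∀ ω, |c j k s ω| ≤ K + K := fun j k s hs ω =>
    (abs_sub _ _).trans (add_le_add (hK s (Ioc_subset_Icc_self hs) _)
      (hK s (Ioc_subset_Icc_self hs) _))
  have hcomp := fun j k => HasIntensity.integral_sum_jump (S.intensity j k) (S.adapted j k)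
    (S.counting j k) htT (S.measurable_rate j k) (S.rate_nonneg j k) (S.rate_le j k)
    (hcm j k) (hcK j k)
  have hw'i : Integrable (fun z => w' z.1 (S.fills z.1 z.2)) S.timeMeasure := by
    refine Integrable.of_bound (S.measurable_comp_fills hwm').aestronglyMeasurable K ?_
    filter_upwards [S.ae_timeMeasure_mem] with z hz
    exact hK' z.1 (Ioc_subset_Icc_self hz) _
  have hci : ∀ j k, Integrable (fun z => c j k z.1 z.2 * S.rate j k z.1 z.2) S.timeMeasure := by
    intro j k
    refine Integrable.of_bound (((hcm j k).mono predictableσ_le le_rfl).mul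
      (S.measurable_rate j k)).aestronglyMeasurable ((K + K) * M.Λ j k) ?_
    filter_upwards [S.ae_timeMeasure_mem] with z hz
    rw [Real.norm_eq_abs, abs_mul, abs_of_nonneg (S.rate_nonneg _ _ _ _)]
    have h1 := hcK j k z.1 hz z.2
    exact mul_le_mul h1 (S.rate_le _ _ _ _) (S.rate_nonneg _ _ _ _) ((abs_nonneg _).trans h1)
  have hsumi : Integrable (fun z => ∑ j, ∑ k, c j k z.1 z.2 * S.rate j k z.1 z.2)
      S.timeMeasure :=
    integrable_finsetSum _ fun j _ => integrable_finsetSum _ fun k _ => hci j k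
  have hcongr : (fun z : ℝ × S.Ω => w' z.1 (S.fills z.1 z.2) + ∑ j, ∑ k,
      (w z.1 (S.fills z.1 z.2 + oneFill j k) - w z.1 (S.fills z.1 z.2)) * S.rate j k z.1 z.2)
      =ᵐ[S.timeMeasure] fun z => w' z.1 (S.fills z.1 z.2) +
        ∑ j, ∑ k, c j k z.1 z.2 * S.rate j k z.1 z.2 := by
    filter_upwards [S.ae_fills_eq_fillsLeft] with z hz
    simp only [hc, hz]
  refine ⟨(hw'i.add hsumi).congr hcongr.symm, ?_⟩
  rw [integral_congr_ae hcongr, integral_add hw'i hsumi]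
  have hpath : ∀ ω, w M.T (S.fills M.T ω) - w t 0 =
      (∫ s in Ioc t M.T, w' s (S.fills s ω)) + ∑ j, ∑ k,
        ∑ s ∈ (S.counting j k ω).jumpTimes M.T,
          c j k s ω * (jumpAt (fun r => S.N j k r ω) s : ℝ) := by
    intro ω
    have hint : IntervalIntegrable (fun r => w' r (S.fills r ω)) volume t M.T := by
      rw [intervalIntegrable_iff_integrableOn_Ioc_of_le htT]
      refine Integrable.of_bound ((S.measurable_comp_fills hwm').comp
        measurable_prodMk_right).aestronglyMeasurable K ?_
      filter_upwards [ae_restrict_mem measurableSet_Ioc] with s hs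
      exact hK' s (Ioc_subset_Icc_self hs) _
    have h := sub_eq_integral_add_sum_jumps htT (p := fun s => S.fills s ω)
      (pL := fun s => S.fillsLeft s ω) (S.eventually_fills_right ω) (S.eventually_fills_left ω)
      (S.jumpTimes ω) (fun s hs h => S.fills_eq_fillsLeft hs h)
      (fun s hs => (S.mem_jumpTimes.1 hs).1.1) (fun s hs => (S.mem_jumpTimes.1 hs).1.2)
      w w' hw hint
    have h0 : S.fills t ω = 0 := by
      ext j k
      exact (S.counting j k ω).start t le_rfl
    rw [h0] at h
    rw [h, intervalIntegral.integral_of_le htT]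
    congr 1
    rw [Finset.sum_congr rfl fun s _ => S.jump_eq_sum (w s) ω s, Finset.sum_comm]
    refine Finset.sum_congr rfl fun j _ => ?_
    rw [Finset.sum_comm]
    refine Finset.sum_congr rfl fun k _ => ?_
    -- The sum runs over the jump times of all processes; those at which `N j k` itself does not
    -- jump contribute zero.
    refine (Finset.sum_subset ?_ ?_).symm
    · intro s hs
      rw [IsCountingPath.mem_jumpTimes] at hs
      exact S.mem_jumpTimes.2 ⟨hs.1, j, k, hs.2⟩
    · intro s hs hs'
      rw [IsCountingPath.mem_jumpTimes, not_and, not_not] at hs'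
      simp [hs' (S.mem_jumpTimes.1 hs).1]
  have hwT : Integrable (fun ω => w M.T (S.fills M.T ω)) S.P := by
    refine Integrable.of_bound ((S.measurable_comp_fills hwm).comp
      measurable_prodMk_left).aestronglyMeasurable K ?_
    exact Eventually.of_forall fun ω => hK M.T ⟨htT, le_rfl⟩ _
  have hE : ∫ ω, w M.T (S.fills M.T ω) ∂S.P - w t 0 =
      ∫ ω, (w M.T (S.fills M.T ω) - w t 0) ∂S.P := by
    rw [integral_sub hwT (integrable_const _)]
    simp
  have hji : ∀ j, Integrable (fun ω => ∑ k, ∑ s ∈ (S.counting j k ω).jumpTimes M.T,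
      c j k s ω * (jumpAt (fun r => S.N j k r ω) s : ℝ)) S.P :=
    fun j => integrable_finsetSum _ fun k _ => (hcomp j k).1
  rw [hE, integral_congr_ae (Eventually.of_forall hpath), integral_add]
  · congr 1
    · exact (integral_prod_symm _ hw'i).symm
    · rw [integral_finsetSum _ fun j _ => hji j,
        integral_finsetSum _ fun j _ => integrable_finsetSum _ fun k _ => hci j k]
      refine Finset.sum_congr rfl fun j _ => ?_
      rw [integral_finsetSum _ fun k _ => (hcomp j k).1, integral_finsetSum _ fun k _ => hci j k]
      exact Finset.sum_congr rfl fun k _ => (hcomp j k).2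
  · exact hw'i.integral_prod_right
  · exact integrable_finsetSum _ fun j _ => hji j

end ControlledSystem

/-! ### The Hamilton-Jacobi-Bellman equation and its maximizer. -/

namespace Market

variable {d : ℕ} (M : Market d)

/-- The part of the running reward that does not depend on the fills. -/
noncomputable def holding (x : Fin d → ℝ) : ℝ :=
  (∑ j, x j * M.δ j * M.μ) - (∑ j, M.κa j / 2 * M.σ ^ 2 * (x j * M.δ j) ^ 2)
    - M.κ / 2 * M.σ ^ 2 * (∑ j, x j * M.δ j) ^ 2

lemma exists_bound_inventories (g : (Fin d → ℝ) → ℝ) : ∃ K, ∀ x ∈ M.inventories, |g x| ≤ K := by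
  obtain ⟨K, hK⟩ := (M.finite_inventories.image fun x => |g x|).bddAbove
  exact ⟨K, fun x hx => hK (mem_image_of_mem _ hx)⟩

lemma exists_bound_of_continuousOn {f : ℝ → (Fin d → ℝ) → ℝ}
    (hf : ∀ x ∈ M.inventories, ContinuousOn (fun s => f s x) (Icc 0 M.T)) :
    ∃ K, ∀ s ∈ Icc 0 M.T, ∀ x ∈ M.inventories, |f s x| ≤ K := by
  have h1 : ∀ x, ∃ K, x ∈ M.inventories → ∀ s ∈ Icc 0 M.T, |f s x| ≤ K := by
    intro x
    by_cases hx : x ∈ M.inventories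
    · obtain ⟨K, hK⟩ := isCompact_Icc.exists_bound_of_continuousOn (hf x hx)
      exact ⟨K, fun _ => hK⟩
    · exact ⟨0, fun h => absurd h hx⟩
  choose b hb using h1
  obtain ⟨K, hK⟩ := M.exists_bound_inventories b
  exact ⟨K, fun s hs x hx => (hb x hx s hs).trans ((le_abs_self _).trans (hK x hx))⟩

open Classical in
/-- A function of time and inventory as a function of time and fills, set to `0` off
`[0,T] × 𝒬`. -/
noncomputable def ofFills (f : ℝ → (Fin d → ℝ) → ℝ) (q : Fin d → ℝ) (s : ℝ)
    (n : Fin d → Side → ℕ) : ℝ :=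
  if M.inventory q n ∈ M.inventories then (Icc 0 M.T).indicator (fun r => f r (M.inventory q n)) s
  else 0

variable {M} {f : ℝ → (Fin d → ℝ) → ℝ} {q : Fin d → ℝ}

lemma ofFills_of_mem {s : ℝ} (hs : s ∈ Icc 0 M.T) {n : Fin d → Side → ℕ}
    (hn : M.inventory q n ∈ M.inventories) : M.ofFills f q s n = f s (M.inventory q n) := by
  rw [ofFills, if_pos hn, indicator_of_mem hs]

lemma measurable_ofFills
    (hf : ∀ x ∈ M.inventories, ContinuousOn (fun s => f s x) (Icc 0 M.T))
    (n : Fin d → Side → ℕ) : Measurable fun s => M.ofFills f q s n := by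
  classical
  by_cases hn : M.inventory q n ∈ M.inventories
  · simp only [ofFills, if_pos hn]
    rw [show (fun s => (Icc 0 M.T).indicator (fun r => f r (M.inventory q n)) s) =
      (Icc 0 M.T).piecewise (fun r => f r (M.inventory q n)) 0 from
        (piecewise_eq_indicator (s := Icc 0 M.T)).symm]
    exact (hf _ hn).measurable_piecewise continuousOn_const measurableSet_Icc
  · simp only [ofFills, if_neg hn]
    exact measurable_const

lemma abs_ofFills_le {K : ℝ} (hK : ∀ s ∈ Icc 0 M.T, ∀ x ∈ M.inventories, |f s x| ≤ K)
    {s : ℝ} (hs : s ∈ Icc 0 M.T) (n : Fin d → Side → ℕ) : |M.ofFills f q s n| ≤ |K| := by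
  by_cases hn : M.inventory q n ∈ M.inventories
  · rw [ofFills_of_mem hs hn]
    exact (hK s hs _ hn).trans (le_abs_self _)
  · simp [ofFills, if_neg hn]

namespace IsHJBSolution

variable {v : ℝ → (Fin d → ℝ) → ℝ}

lemma continuousOn (hv : M.IsHJBSolution v) : ∀ x ∈ M.inventories,
    ContinuousOn (fun s => v s x) (Icc 0 M.T) :=
  fun x hx => (hv.contDiffOn x hx).continuousOn

lemma continuousOn_deriv (hv : M.IsHJBSolution v) : ∀ x ∈ M.inventories,
    ContinuousOn (fun s => derivWithin (fun r => v r x) (Icc 0 M.T) s) (Icc 0 M.T) :=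
  fun x hx => (hv.contDiffOn x hx).continuousOn_derivWithin (uniqueDiffOn_Icc M.T_pos) le_rfl

lemma integral_deriv (hv : M.IsHJBSolution v) {x : Fin d → ℝ} (hx : x ∈ M.inventories) {a b : ℝ}
    (ha : a ∈ Icc 0 M.T) (hb : b ∈ Icc 0 M.T) (hab : a ≤ b) :
    ∫ r in a..b, derivWithin (fun r => v r x) (Icc 0 M.T) r = v b x - v a x := by
  have hsub : uIcc a b ⊆ Icc 0 M.T := uIcc_subset_Icc ha hb
  refine intervalIntegral.integral_eq_sub_of_hasDeriv_right
    ((hv.continuousOn x hx).mono hsub) ?_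
    (((hv.continuousOn_deriv x hx).mono hsub).intervalIntegrable)
  intro r hr
  rw [min_eq_left hab, max_eq_right hab] at hr
  have hmem : Icc 0 M.T ∈ 𝓝 r := Icc_mem_nhds (ha.1.trans_lt hr.1) (hr.2.trans_le hb.2)
  have hd := ((hv.contDiffOn x hx).differentiableOn one_ne_zero r (mem_of_mem_nhds hmem))
  exact (hd.hasDerivWithinAt.hasDerivAt hmem).hasDerivWithinAt

lemma sSup_image_zero_one (a x : ℝ) :
    sSup ((fun l : ℝ => l * a * x) '' {0, 1}) = max 0 (a * x) := by
  rw [image_pair, csSup_pair]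
  simp

lemma equation_holding (hv : M.IsHJBSolution v) {s : ℝ} (hs : s ∈ Icc 0 M.T) {x : Fin d → ℝ}
    (hx : x ∈ M.inventories) :
    M.holding x + derivWithin (fun r => v r x) (Icc 0 M.T) s = - ∑ j, ∑ k, M.room x j k *
      max 0 (M.Λ j k * (M.m j * (M.D j / 2) + v s (M.shift x j k) - v s x)) := by
  have h := hv.equation s hs x hx
  simp only [sSup_image_zero_one] at h
  have h1 : ∑ j, x j * M.δ j * M.μ = M.μ * ∑ j, x j * M.δ j := by
    rw [← Finset.sum_mul, mul_comm]
  rw [holding, h1]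
  linarith

/-- Since `m j` is positive and `Λ j k` nonnegative, the threshold test decides the sign of the
product inside the maximum. At equality the product is zero, so the tie-breaking is immaterial;
without room both sides vanish. -/
lemma feedback_mul {s : ℝ} (x : Fin d → ℝ) (j : Fin d) (k : Side) :
    M.feedback v s x j k * M.room x j k *
      (M.Λ j k * (M.m j * (M.D j / 2) + v s (M.shift x j k) - v s x)) =
    M.room x j k * max 0 (M.Λ j k * (M.m j * (M.D j / 2) + v s (M.shift x j k) - v s x)) := by
  by_cases hr : x j + k.sign * M.m j ∈ M.levels j
  · rw [M.room_of_mem hr]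
    have hm := M.m_pos j
    have hL := M.Λ_nonneg j k
    by_cases hd : (v s x - v s (M.shift x j k)) / M.m j ≤ M.D j / 2
    · rw [feedback, if_pos ⟨hr, hd⟩, max_eq_right]
      · ring
      · rw [div_le_iff₀ hm] at hd
        exact mul_nonneg hL (by linarith only [hd])
    · rw [feedback, if_neg fun h => hd h.2, max_eq_left]
      · simp
      · rw [not_le, lt_div_iff₀ hm] at hd
        exact mul_nonpos_of_nonneg_of_nonpos hL (by linarith only [hd])
  · rw [M.room_of_notMem hr]
    ring

end IsHJBSolution

end Market

/-! ### Verification: the value is the performance plus the expected loss. -/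

namespace ControlledSystem

variable {d : ℕ} {M : Market d} {t : ℝ} {q : Fin d → ℝ} {v : ℝ → (Fin d → ℝ) → ℝ}
  (S : ControlledSystem M t q)

lemma timeMeasure_real_univ (htT : t ≤ M.T) : S.timeMeasure.real univ = M.T - t := by
  rw [timeMeasure, ← univ_prod_univ, measureReal_prod_prod]
  simp [htT]

/-- The inventory never leaves `𝒬`, up to null sets. -/
lemma ae_inv_mem (htT : t ≤ M.T) (hq : q ∈ M.inventories) :
    ∀ᵐ z ∂S.timeMeasure, S.inv z.1 z.2 ∈ M.inventories := by
  classical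
  set I : (Fin d → Side → ℕ) → ℝ := fun n => if M.inventory q n ∈ M.inventories then 1 else 0
    with hI
  have hI0 : ∀ n, 0 ≤ I n := fun n => by simp only [hI]; split_ifs <;> norm_num
  have hI1 : ∀ n, I n ≤ 1 := fun n => by simp only [hI]; split_ifs <;> norm_num
  have hIq : I 0 = 1 := by simp [hI, M.inventory_zero, hq]
  -- The factor `M.T - s` removes the terminal term, so Dynkin's formula says that the generator
  -- term `F` below integrates to `-(M.T - t)`, minus the total mass. Fills cannot leave `𝒬`, so `F
  -- ≥ -1`; hence `F = -1` almost everywhere. Off `𝒬` one has `F ≥ 0`, so that event is null.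
  have hdyn := S.dynkin htT (w := fun s n => (M.T - s) * I n) (w' := fun _ n => - I n)
    (K := max (M.T - t) 1) (fun n => by fun_prop) (fun n => measurable_const) ?_ ?_ ?_
  · obtain ⟨hint, heq⟩ := hdyn
    simp only [sub_self, zero_mul, integral_zero, hIq] at heq
    set F := fun z : ℝ × S.Ω => -I (S.fills z.1 z.2) + ∑ j, ∑ k,
      ((M.T - z.1) * I (S.fills z.1 z.2 + oneFill j k) - (M.T - z.1) * I (S.fills z.1 z.2)) *
        S.rate j k z.1 z.2 with hF
    have hsum : ∀ z : ℝ × S.Ω, z.1 ≤ M.T → 0 ≤ ∑ j, ∑ k,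
      ((M.T - z.1) * I (S.fills z.1 z.2 + oneFill j k) - (M.T - z.1) * I (S.fills z.1 z.2)) *
        S.rate j k z.1 z.2 := by
      intro z hz
      refine Finset.sum_nonneg fun j _ => Finset.sum_nonneg fun k _ => ?_
      rw [← mul_sub]
      have h1 : 0 ≤ M.T - z.1 := sub_nonneg.2 hz
      by_cases hn : M.inventory q (S.fills z.1 z.2) ∈ M.inventories
      · by_cases hr : S.inv z.1 z.2 j + k.sign * M.m j ∈ M.levels j
        · have : M.inventory q (S.fills z.1 z.2 + oneFill j k) ∈ M.inventories := by
            rw [M.inventory_add_oneFill]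
            exact M.shift_mem_inventories hn hr
          simp [hI, hn, this]
        · simp [rate, M.room_of_notMem hr]
      · have : I (S.fills z.1 z.2) = 0 := by simp [hI, hn]
        rw [this, sub_zero]
        exact mul_nonneg (mul_nonneg h1 (hI0 _)) (S.rate_nonneg _ _ _ _)
    have hnn : 0 ≤ᵐ[S.timeMeasure] fun z => 1 + F z := by
      filter_upwards [S.ae_timeMeasure_mem] with z hz
      have := hsum z hz.2
      have := hI1 (S.fills z.1 z.2)
      simp only [Pi.zero_apply, hF]
      linarith
    have hzero : ∫ z, (1 + F z) ∂S.timeMeasure = 0 := by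
      rw [integral_add (integrable_const _) hint, ← heq]
      simp [S.timeMeasure_real_univ htT]
    rw [integral_eq_zero_iff_of_nonneg_ae hnn ((integrable_const _).add hint)] at hzero
    filter_upwards [hzero, S.ae_timeMeasure_mem] with z hz hzT
    have := hsum z hzT.2
    simp only [hF, Pi.zero_apply] at hz
    by_contra hn
    have h0 : I (S.fills z.1 z.2) = 0 := if_neg hn
    rw [h0] at hz this
    linarith
  · intro s hs n
    rw [abs_of_nonneg (mul_nonneg (sub_nonneg.2 hs.2) (hI0 n))]
    refine le_max_of_le_left ?_
    calc (M.T - s) * I n ≤ (M.T - s) * 1 :=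
          mul_le_mul_of_nonneg_left (hI1 n) (sub_nonneg.2 hs.2)
      _ ≤ M.T - t := by linarith [hs.1]
  · intro s _ n
    rw [abs_neg, abs_of_nonneg (hI0 n)]
    exact le_max_of_le_right (hI1 n)
  · intro n a _ b _ _
    rw [intervalIntegral.integral_const, smul_eq_mul]
    ring

lemma integrable_comp_inv (htT : t ≤ M.T) (hq : q ∈ M.inventories) (g : (Fin d → ℝ) → ℝ) :
    Integrable (fun z => g (S.inv z.1 z.2)) S.timeMeasure := by
  obtain ⟨K, hK⟩ := M.exists_bound_inventories g
  refine Integrable.of_bound (S.measurable_comp_fills (g := fun _ n => g (M.inventory q n))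
    fun _ => measurable_const).aestronglyMeasurable K ?_
  filter_upwards [S.ae_inv_mem htT hq] with z hz
  exact hK _ hz

lemma integrable_rate (j : Fin d) (k : Side) :
    Integrable (fun z => S.rate j k z.1 z.2) S.timeMeasure := by
  refine Integrable.of_bound (S.measurable_rate j k).aestronglyMeasurable (M.Λ j k) ?_
  refine Eventually.of_forall fun z => ?_
  rw [Real.norm_eq_abs, abs_of_nonneg (S.rate_nonneg _ _ _ _)]
  exact S.rate_le _ _ _ _

/-- The running reward. -/
noncomputable def reward (z : ℝ × S.Ω) : ℝ :=
  (∑ j, ∑ k, M.D j / 2 * M.m j * S.rate j k z.1 z.2) + M.holding (S.inv z.1 z.2)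

lemma integrable_reward (htT : t ≤ M.T) (hq : q ∈ M.inventories) :
    Integrable S.reward S.timeMeasure :=
  (integrable_finsetSum _ fun j _ => integrable_finsetSum _ fun k _ =>
    (S.integrable_rate j k).const_mul _).add (S.integrable_comp_inv htT hq M.holding)

/-- Merging the separate time integrals requires each section to be integrable in time; Fubini
supplies this for almost every `ω`. -/
lemma payoff_ae_eq (htT : t ≤ M.T) (hq : q ∈ M.inventories) :
    S.payoff =ᵐ[S.P] fun ω => ∫ s in Ioc t M.T, S.reward (s, ω) := by
  have h1 := fun j k => (S.integrable_rate j k).prod_left_ae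
  have h2 := fun j => (S.integrable_comp_inv htT hq fun x => x j * M.δ j * M.μ).prod_left_ae
  have h3 := fun j => (S.integrable_comp_inv htT hq fun x => (x j * M.δ j) ^ 2).prod_left_ae
  have h4 := (S.integrable_comp_inv htT hq fun x => (∑ j, x j * M.δ j) ^ 2).prod_left_ae
  filter_upwards [ae_all_iff.2 fun j => ae_all_iff.2 fun k => h1 j k, ae_all_iff.2 h2,
    ae_all_iff.2 h3, h4] with ω h1 h2 h3 h4
  simp only [payoff, intervalIntegral.integral_of_le htT]
  rw [← integral_const_mul]
  simp only [← integral_const_mul]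
  have h5 : Integrable (fun s => ∑ j, ((∑ k, M.D j / 2 * M.m j * S.l j k s ω * M.Λ j k *
      M.room (S.inv s ω) j k) + S.inv s ω j * M.δ j * M.μ)) (volume.restrict (Ioc t M.T)) := by
    refine integrable_finsetSum _ fun j _ => (integrable_finsetSum _ fun k _ => ?_).add (h2 j)
    refine ((h1 j k).const_mul (M.D j / 2 * M.m j)).congr (Eventually.of_forall fun s => ?_)
    simp only [rate]
    ring
  have h6 : Integrable (fun s => ∑ j, M.κa j / 2 * M.σ ^ 2 * (S.inv s ω j * M.δ j) ^ 2)
      (volume.restrict (Ioc t M.T)) :=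
    integrable_finsetSum _ fun j _ => (h3 j).const_mul _
  rw [← integral_finsetSum _ fun j _ => (h3 j).const_mul _, ← integral_sub h5 h6,
    ← integral_sub (by exact h5.sub h6) (h4.const_mul _)]
  refine integral_congr_ae (Eventually.of_forall fun s => ?_)
  simp only [reward, Market.holding, rate, Finset.sum_add_distrib]
  have : ∀ j k, M.D j / 2 * M.m j * S.l j k s ω * M.Λ j k * M.room (S.inv s ω) j k =
      M.D j / 2 * M.m j * (S.l j k s ω * M.Λ j k * M.room (S.inv s ω) j k) := by
    intros
    ring
  simp only [this]
  ring

lemma integrable_payoff (htT : t ≤ M.T) (hq : q ∈ M.inventories) :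
    Integrable S.payoff S.P :=
  (S.integrable_reward htT hq).integral_prod_right.congr (S.payoff_ae_eq htT hq).symm

lemma performance_eq (htT : t ≤ M.T) (hq : q ∈ M.inventories) :
    S.performance = ∫ z, S.reward z ∂S.timeMeasure := by
  rw [performance, integral_congr_ae (S.payoff_ae_eq htT hq)]
  exact (integral_prod_symm _ (S.integrable_reward htT hq)).symm

/-- The loss of a decision rule against the maximizer in the Hamilton-Jacobi-Bellman system. -/
noncomputable def loss (v : ℝ → (Fin d → ℝ) → ℝ) (z : ℝ × S.Ω) : ℝ :=
  ∑ j, ∑ k, M.room (S.inv z.1 z.2) j k *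
    (max 0 (M.Λ j k * (M.m j * (M.D j / 2) + v z.1 (M.shift (S.inv z.1 z.2) j k) -
        v z.1 (S.inv z.1 z.2))) -
      S.l j k z.1 z.2 * (M.Λ j k * (M.m j * (M.D j / 2) +
        v z.1 (M.shift (S.inv z.1 z.2) j k) - v z.1 (S.inv z.1 z.2))))

lemma loss_nonneg (v : ℝ → (Fin d → ℝ) → ℝ) (z : ℝ × S.Ω) : 0 ≤ S.loss v z := by
  refine Finset.sum_nonneg fun j _ => Finset.sum_nonneg fun k _ =>
    mul_nonneg (M.room_nonneg _ _ _) (sub_nonneg.2 ?_)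
  rcases S.control_mem j k z.1 z.2 with h | h <;> simp [h]

/-- Because `v` vanishes at the horizon, Dynkin's formula makes `-v t q` the integral of the
generator applied to `v`. The equation turns the negative of that generator term, minus the running
reward, into `loss`. -/
lemma value_eq_performance_add (hv : M.IsHJBSolution v) (ht : t ∈ Icc 0 M.T)
    (hq : q ∈ M.inventories) : v t q = S.performance + ∫ z, S.loss v z ∂S.timeMeasure := by
  obtain ⟨K, hK⟩ := M.exists_bound_of_continuousOn hv.continuousOn
  obtain ⟨K', hK'⟩ := M.exists_bound_of_continuousOn hv.continuousOn_deriv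
  have hsub : Icc t M.T ⊆ Icc 0 M.T := Icc_subset_Icc_left ht.1
  have hdyn := S.dynkin ht.2 (w := M.ofFills v q)
    (w' := M.ofFills (fun s x => derivWithin (fun r => v r x) (Icc 0 M.T) s) q)
    (K := max |K| |K'|) (Market.measurable_ofFills hv.continuousOn)
    (Market.measurable_ofFills hv.continuousOn_deriv)
    (fun s hs n => (Market.abs_ofFills_le hK (hsub hs) n).trans (le_max_left _ _))
    (fun s hs n => (Market.abs_ofFills_le hK' (hsub hs) n).trans (le_max_right _ _)) ?_
  · obtain ⟨hint, heq⟩ := hdyn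
    have h0 : M.ofFills v q t 0 = v t q := by
      rw [Market.ofFills_of_mem ht] <;> simp [M.inventory_zero, hq]
    have hT : ∀ n, M.ofFills v q M.T n = 0 := by
      intro n
      by_cases hn : M.inventory q n ∈ M.inventories
      · rw [Market.ofFills_of_mem ⟨M.T_pos.le, le_rfl⟩ hn, hv.terminal _ hn]
      · simp [Market.ofFills, hn]
    simp only [hT, h0, integral_zero] at heq
    have hae : ∀ᵐ z ∂S.timeMeasure, S.loss v z = -(M.ofFills (fun s x =>
        derivWithin (fun r => v r x) (Icc 0 M.T) s) q z.1 (S.fills z.1 z.2) + ∑ j, ∑ k,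
      (M.ofFills v q z.1 (S.fills z.1 z.2 + oneFill j k) - M.ofFills v q z.1 (S.fills z.1 z.2)) *
        S.rate j k z.1 z.2) - S.reward z := by
      filter_upwards [S.ae_timeMeasure_mem, S.ae_inv_mem ht.2 hq] with z hz hinv
      have hz' := hsub (Ioc_subset_Icc_self hz)
      have hE := hv.equation_holding hz' hinv
      rw [S.inv_eq] at hinv
      -- Where a fill would leave `𝒬` the rate is zero, so the zero extension in `ofFills` never
      -- matters.
      have hterm : ∀ j k, (M.ofFills v q z.1 (S.fills z.1 z.2 + oneFill j k) -
          M.ofFills v q z.1 (S.fills z.1 z.2)) * S.rate j k z.1 z.2 =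
          (v z.1 (M.shift (S.inv z.1 z.2) j k) - v z.1 (S.inv z.1 z.2)) *
            S.rate j k z.1 z.2 := by
        intro j k
        by_cases hr : S.inv z.1 z.2 j + k.sign * M.m j ∈ M.levels j
        · rw [Market.ofFills_of_mem hz' hinv, Market.ofFills_of_mem hz', M.inventory_add_oneFill]
          · rfl
          · rw [M.inventory_add_oneFill]
            exact M.shift_mem_inventories hinv hr
        · simp [rate, M.room_of_notMem hr]
      simp only [hterm]
      rw [Market.ofFills_of_mem hz' hinv, ← S.inv_eq]
      simp only [reward, loss]
      -- The regrouping brings the holding reward next to the time derivative, the combination that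
      -- `hE` evaluates.
      rw [show ∀ a b c e : ℝ, -(a + b) - (c + e) = -(e + a) - (b + c) by intros; ring, hE,
        neg_neg, ← Finset.sum_add_distrib, ← Finset.sum_sub_distrib]
      refine Finset.sum_congr rfl fun j _ => ?_
      rw [← Finset.sum_add_distrib, ← Finset.sum_sub_distrib]
      refine Finset.sum_congr rfl fun k _ => ?_
      simp only [rate]
      ring
    rw [integral_congr_ae hae, integral_sub (by exact hint.neg) (S.integrable_reward ht.2 hq),
      integral_neg, ← heq, S.performance_eq ht.2 hq]
    ring
  · intro n a ha b hb hab
    by_cases hn : M.inventory q n ∈ M.inventories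
    · rw [Market.ofFills_of_mem (hsub ha) hn, Market.ofFills_of_mem (hsub hb) hn,
        ← hv.integral_deriv hn (hsub ha) (hsub hb) hab]
      refine intervalIntegral.integral_congr fun r hr => ?_
      exact Market.ofFills_of_mem (uIcc_subset_Icc (hsub ha) (hsub hb) hr) hn
    · simp [Market.ofFills, hn]

lemma performance_le (hv : M.IsHJBSolution v) (ht : t ∈ Icc 0 M.T)
    (hq : q ∈ M.inventories) : S.performance ≤ v t q := by
  rw [S.value_eq_performance_add hv ht hq]
  exact le_add_of_nonneg_right (integral_nonneg (S.loss_nonneg v))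

lemma performance_of_followsFeedback (hv : M.IsHJBSolution v) (ht : t ∈ Icc 0 M.T)
    (hq : q ∈ M.inventories) (hS : S.FollowsFeedback v) : S.performance = v t q := by
  have : ∀ᵐ z ∂S.timeMeasure, S.loss v z = 0 := by
    filter_upwards [S.ae_timeMeasure_mem, S.ae_fills_eq_fillsLeft] with z hz hfill
    refine Finset.sum_eq_zero fun j _ => Finset.sum_eq_zero fun k _ => ?_
    have h1 : S.invLeft z.1 z.2 = S.inv z.1 z.2 := by rw [S.inv_eq, S.invLeft_eq, hfill]
    rw [hS z.1 hz z.2 j k, h1, mul_sub, ← Market.IsHJBSolution.feedback_mul]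
    ring
  rw [S.value_eq_performance_add hv ht hq, integral_congr_ae this]
  simp

end ControlledSystem

/-! ### Thinning a finite configuration of potential fills. -/

instance : MeasurableSpace Side := ⊤

instance : DiscreteMeasurableSpace Side := ⟨fun _ => trivial⟩

/-- A point process of potential fills: times, each marked with an asset and a side. -/
abbrev Marks (d n : ℕ) : Type := Fin n → ℝ × (Fin d × Side)

namespace Marks

variable {d n : ℕ}

/-- Insert a point at position `i`. -/
def insert (i : Fin (n + 1)) (y : ℝ × (Fin d × Side)) (x : Marks d n) : Marks d (n + 1) :=
  Fin.insertNth (α := fun _ => ℝ × (Fin d × Side)) i y x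

@[simp] lemma insert_same (i : Fin (n + 1)) (y : ℝ × (Fin d × Side)) (x : Marks d n) :
    insert i y x i = y := Fin.insertNth_apply_same _ _ _

@[simp] lemma insert_succAbove (i : Fin (n + 1)) (y : ℝ × (Fin d × Side)) (x : Marks d n)
    (l : Fin n) : insert i y x (i.succAbove l) = x l := Fin.insertNth_apply_succAbove _ _ _ _

variable (rule : ℝ → (Fin d → Side → ℕ) → Fin d × Side → Prop)

open Classical in
/-- Picard iteration for the set of potential fills that take place: a potential fill takes place
if no other one has the same time and if `rule` allows it given the earlier fills. -/
def Accept (x : Marks d n) : ℕ → Fin n → Prop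
  | 0, _ => False
  | m + 1, i => (∀ l, (x l).1 = (x i).1 → l = i) ∧ rule (x i).1 (fun j k =>
      ∑ l, if (x l).2 = (j, k) ∧ (x l).1 < (x i).1 ∧ Accept x m l then 1 else 0) (x i).2

/-- The potential fills that take place. -/
def Kept (x : Marks d n) (i : Fin n) : Prop := Accept rule x n i

open Classical in
/-- The fills before time `s`. -/
noncomputable def before (x : Marks d n) (s : ℝ) (j : Fin d) (k : Side) : ℕ :=
  ∑ l, if (x l).2 = (j, k) ∧ (x l).1 < s ∧ Kept rule x l then 1 else 0

open Classical in
/-- The fills up to time `s`. -/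
noncomputable def upTo (x : Marks d n) (s : ℝ) (j : Fin d) (k : Side) : ℕ :=
  ∑ l, if (x l).2 = (j, k) ∧ (x l).1 ≤ s ∧ Kept rule x l then 1 else 0

open Classical in
/-- The fills at time `s`. -/
noncomputable def atTime (x : Marks d n) (s : ℝ) (j : Fin d) (k : Side) : ℕ :=
  ∑ l, if (x l).2 = (j, k) ∧ (x l).1 = s ∧ Kept rule x l then 1 else 0

/-- The number of potential fills earlier than the `i`-th one. -/
noncomputable def rank (x : Marks d n) (i : Fin n) : ℕ :=
  (Finset.univ.filter fun l => (x l).1 < (x i).1).card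

lemma rank_lt (x : Marks d n) (i : Fin n) : rank x i < n := by
  have : (Finset.univ.filter fun l => (x l).1 < (x i).1) ⊂ Finset.univ := by
    rw [Finset.filter_ssubset]
    exact ⟨i, Finset.mem_univ _, lt_irrefl _⟩
  simpa [rank] using Finset.card_lt_card this

lemma rank_lt_rank {x : Marks d n} {l i : Fin n} (h : (x l).1 < (x i).1) :
    rank x l < rank x i := by
  refine Finset.card_lt_card ((Finset.ssubset_iff_of_subset ?_).2 ⟨l, by simpa using h, by simp⟩)
  intro a ha
  simp only [Finset.mem_filter, Finset.mem_univ, true_and] at ha ⊢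
  exact ha.trans h

variable {rule}

/-- The decision on a point uses only decisions on strictly earlier points, which have smaller rank.
The iteration is thus settled at `i` once it has run more than `rank x i` times. -/
lemma accept_succ_iff (x : Marks d n) : ∀ m i, rank x i < m →
    (Accept rule x (m + 1) i ↔ Accept rule x m i) := by
  classical
  intro m
  induction m with
  | zero => intro i hi; omega
  | succ m ih =>
    intro i hi
    have : ∀ l, (x l).1 < (x i).1 → (Accept rule x (m + 1) l ↔ Accept rule x m l) :=
      fun l hl => ih l (by have := rank_lt_rank hl; omega)
    rw [Accept, Accept]
    refine and_congr_right fun _ => iff_of_eq ?_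
    congr 1
    ext j k
    refine Finset.sum_congr rfl fun l _ => ?_
    exact if_congr (and_congr_right fun _ => and_congr_right fun hl => this l hl) rfl rfl

/-- Ranks are below `n`, so `n` iterations reach the fixed point. -/
lemma kept_iff (x : Marks d n) (i : Fin n) : Kept rule x i ↔
    (∀ l, (x l).1 = (x i).1 → l = i) ∧ rule (x i).1 (before rule x (x i).1) (x i).2 := by
  rw [Kept, ← accept_succ_iff x n i (rank_lt x i), Accept]
  rfl

/-- Causality of the thinning, by induction on rank. The inserted point is strictly later, so it
creates no tie at the time of `x i` and no earlier fill. -/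
lemma kept_insert (p : Fin (n + 1)) (y : ℝ × (Fin d × Side)) (x : Marks d n) :
    ∀ i, (x i).1 < y.1 → (Kept rule (insert p y x) (p.succAbove i) ↔ Kept rule x i) := by
  classical
  suffices h : ∀ m i, rank x i < m → (x i).1 < y.1 →
      (Kept rule (insert p y x) (p.succAbove i) ↔ Kept rule x i) from
    fun i => h _ i (Nat.lt_succ_self _)
  intro m
  induction m with
  | zero => intro i hi; omega
  | succ m ih =>
    intro i hi hiy
    rw [kept_iff, kept_iff]
    simp only [insert_succAbove]
    have h1 : (∀ l, (insert p y x l).1 = (x i).1 → l = p.succAbove i) ↔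
        ∀ l, (x l).1 = (x i).1 → l = i := by
      rw [Fin.forall_iff_succAbove p]
      simp only [insert_same, insert_succAbove, Fin.succAbove_right_inj]
      exact and_iff_right fun h => absurd h hiy.ne'
    have h2 : before rule (insert p y x) (x i).1 = before rule x (x i).1 := by
      ext j k
      rw [before, before, Fin.sum_univ_succAbove _ p, if_neg, zero_add]
      · refine Finset.sum_congr rfl fun l _ => ?_
        refine if_congr ?_ rfl rfl
        rw [insert_succAbove]
        exact (and_congr_right fun _ => and_congr_right fun hl =>
          ih l (by have := rank_lt_rank hl; omega) (hl.trans hiy))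
      · rw [insert_same]
        exact fun h => absurd h.2.1 (not_lt.2 hiy.le)
    rw [h1, h2]

lemma before_insert (p : Fin (n + 1)) (y : ℝ × (Fin d × Side)) (x : Marks d n) {s : ℝ}
    (hs : s ≤ y.1) : before rule (insert p y x) s = before rule x s := by
  classical
  ext j k
  rw [before, before, Fin.sum_univ_succAbove _ p, if_neg, zero_add]
  · refine Finset.sum_congr rfl fun l _ => ?_
    refine if_congr ?_ rfl rfl
    rw [insert_succAbove]
    exact (and_congr_right fun _ => and_congr_right fun hl =>
      kept_insert p y x l (hl.trans_le hs))
  · rw [insert_same]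
    exact fun h => absurd h.2.1 (not_lt.2 hs)

lemma upTo_insert (p : Fin (n + 1)) (y : ℝ × (Fin d × Side)) (x : Marks d n) {s : ℝ}
    (hs : s < y.1) : upTo rule (insert p y x) s = upTo rule x s := by
  classical
  ext j k
  rw [upTo, upTo, Fin.sum_univ_succAbove _ p, if_neg, zero_add]
  · refine Finset.sum_congr rfl fun l _ => ?_
    refine if_congr ?_ rfl rfl
    rw [insert_succAbove]
    exact (and_congr_right fun _ => and_congr_right fun hl =>
      kept_insert p y x l (hl.trans_lt hs))
  · rw [insert_same]
    exact fun h => absurd h.2.1 (not_le.2 hs)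

lemma kept_insert_same (p : Fin (n + 1)) (y : ℝ × (Fin d × Side)) (x : Marks d n) :
    Kept rule (insert p y x) p ↔
      (∀ l, (x l).1 ≠ y.1) ∧ rule y.1 (before rule x y.1) y.2 := by
  rw [kept_iff, insert_same, before_insert p y x le_rfl, Fin.forall_iff_succAbove p]
  simp [Fin.succAbove_ne]

lemma upTo_eq (x : Marks d n) (s : ℝ) (j : Fin d) (k : Side) :
    upTo rule x s j k = before rule x s j k + atTime rule x s j k := by
  rw [upTo, before, atTime, ← Finset.sum_add_distrib]
  refine Finset.sum_congr rfl fun l _ => ?_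
  by_cases h : (x l).2 = (j, k) ∧ Kept rule x l
  · rcases lt_trichotomy (x l).1 s with h' | h' | h'
    · rw [if_pos ⟨h.1, h'.le, h.2⟩, if_pos ⟨h.1, h', h.2⟩, if_neg fun e => h'.ne e.2.1]
    · rw [if_pos ⟨h.1, h'.le, h.2⟩, if_neg fun e => e.2.1.ne h', if_pos ⟨h.1, h', h.2⟩]
    · rw [if_neg fun e => not_le.2 h' e.2.1, if_neg fun e => not_lt.2 h'.le e.2.1,
        if_neg fun e => h'.ne' e.2.1]
  · rw [if_neg fun e => h ⟨e.1, e.2.2⟩, if_neg fun e => h ⟨e.1, e.2.2⟩,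
      if_neg fun e => h ⟨e.1, e.2.2⟩]

lemma atTime_ne_zero {x : Marks d n} {s : ℝ} {j : Fin d} {k : Side} :
    atTime rule x s j k ≠ 0 ↔ ∃ l, (x l).2 = (j, k) ∧ (x l).1 = s ∧ Kept rule x l := by
  simp [atTime]

/-- Points sharing their time with another are all rejected, so at most one point is kept at any
time. -/
lemma atTime_le_one (x : Marks d n) (s : ℝ) (j : Fin d) (k : Side) : atTime rule x s j k ≤ 1 := by
  by_cases h : atTime rule x s j k = 0
  · omega
  · obtain ⟨l, h1, h2, h3⟩ := atTime_ne_zero.1 h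
    rw [atTime, Finset.sum_eq_single l]
    · split_ifs <;> simp
    · intro i _ hi
      rw [if_neg]
      rintro ⟨_, h5, _⟩
      exact hi (((kept_iff x l).1 h3).1 i (h5.trans h2.symm))
    · simp

lemma monotone_upTo (x : Marks d n) (j : Fin d) (k : Side) :
    Monotone fun s => upTo rule x s j k := by
  intro s r hsr
  refine Finset.sum_le_sum fun l _ => ?_
  by_cases h : (x l).2 = (j, k) ∧ (x l).1 ≤ s ∧ Kept rule x l
  · rw [if_pos h, if_pos ⟨h.1, h.2.1.trans hsr, h.2.2⟩]
  · rw [if_neg h]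
    exact Nat.zero_le _

lemma eventually_upTo_right (x : Marks d n) (s : ℝ) (j : Fin d) (k : Side) :
    ∀ᶠ r in 𝓝[≥] s, upTo rule x r j k = upTo rule x s j k := by
  classical
  have : ∀ᶠ r in 𝓝[≥] s, ∀ l, ((x l).1 ≤ r ↔ (x l).1 ≤ s) := by
    rw [eventually_all]
    intro l
    rcases le_or_gt (x l).1 s with h | h
    · filter_upwards [self_mem_nhdsWithin] with r hr
      exact iff_of_true (h.trans hr) h
    · filter_upwards [(eventually_lt_nhds h).filter_mono nhdsWithin_le_nhds] with r hr
      exact iff_of_false (not_le.2 hr) (not_le.2 h)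
  filter_upwards [this] with r hr
  exact Finset.sum_congr rfl fun l _ => if_congr (by rw [hr l]) rfl rfl

lemma eventually_upTo_left (x : Marks d n) (s : ℝ) (j : Fin d) (k : Side) :
    ∀ᶠ r in 𝓝[<] s, upTo rule x r j k = before rule x s j k := by
  classical
  have : ∀ᶠ r in 𝓝[<] s, ∀ l, ((x l).1 ≤ r ↔ (x l).1 < s) := by
    rw [eventually_all]
    intro l
    rcases lt_or_ge (x l).1 s with h | h
    · filter_upwards [(eventually_gt_nhds h).filter_mono nhdsWithin_le_nhds] with r hr
      exact iff_of_true hr.le h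
    · filter_upwards [self_mem_nhdsWithin] with r hr
      exact iff_of_false (not_le.2 ((mem_Iio.1 hr).trans_le h)) (not_lt.2 h)
  filter_upwards [this] with r hr
  exact Finset.sum_congr rfl fun l _ => if_congr (by rw [hr l]) rfl rfl

lemma leftLim_upTo (x : Marks d n) (s : ℝ) (j : Fin d) (k : Side) :
    Function.leftLim (fun r => upTo rule x r j k) s = before rule x s j k :=
  leftLim_eq_of_tendsto
    (tendsto_nhds_of_eventually_eq (eventually_upTo_left x s j k))

lemma jumpAt_upTo (x : Marks d n) (s : ℝ) (j : Fin d) (k : Side) :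
    jumpAt (fun r => upTo rule x r j k) s = atTime rule x s j k := by
  rw [jumpAt, leftLim_upTo, upTo_eq]
  omega

lemma isCountingPath_upTo {t : ℝ} (ht : ∀ s n jk, rule s n jk → t < s) (x : Marks d n)
    (j : Fin d) (k : Side) : IsCountingPath t fun s => upTo rule x s j k where
  start s hs := by
    refine Finset.sum_eq_zero fun l _ => if_neg ?_
    rintro ⟨_, h2, h3⟩
    exact absurd (ht _ _ _ ((kept_iff x l).1 h3).2) (not_lt.2 (h2.trans hs))
  mono := monotone_upTo x j k
  right_continuous s := tendsto_nhds_of_eventually_eq (eventually_upTo_right x s j k)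
  unit_jumps s := by
    rw [leftLim_upTo, upTo_eq]
    have := atTime_le_one (rule := rule) x s j k
    omega

lemma eq_of_atTime_ne_zero {x : Marks d n} {s : ℝ} {j j' : Fin d} {k k' : Side}
    (h : atTime rule x s j k ≠ 0) (h' : atTime rule x s j' k' ≠ 0) : j = j' ∧ k = k' := by
  obtain ⟨l, h1, h2, h3⟩ := atTime_ne_zero.1 h
  obtain ⟨l', h1', h2', _⟩ := atTime_ne_zero.1 h'
  have := ((kept_iff x l).1 h3).1 l' (h2'.trans h2.symm)
  rw [this, h1] at h1'
  exact Prod.mk.inj h1'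

open Classical in
lemma tsum_jumpAt_upTo (t T : ℝ) (x : Marks d n) (j : Fin d) (k : Side) (f : ℝ → ℝ≥0∞) :
    ∑' s : Ioc t T, f s * (jumpAt (fun r => upTo rule x r j k) s : ℝ≥0∞) =
      ∑ l, if (x l).1 ∈ Ioc t T ∧ (x l).2 = (j, k) ∧ Kept rule x l then f (x l).1 else 0 := by
  have h1 : ∀ s : Ioc t T, f s * (jumpAt (fun r => upTo rule x r j k) s : ℝ≥0∞) =
      ∑ l, if (x l).2 = (j, k) ∧ (x l).1 = s ∧ Kept rule x l then f (x l).1 else 0 := by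
    intro s
    rw [jumpAt_upTo, atTime]
    push_cast
    rw [Finset.mul_sum]
    refine Finset.sum_congr rfl fun l _ => ?_
    split_ifs with h
    · rw [h.2.1, mul_one]
    · rw [mul_zero]
  simp only [h1]
  rw [Summable.tsum_finsetSum fun _ _ => ENNReal.summable]
  refine Finset.sum_congr rfl fun l _ => ?_
  by_cases hl : (x l).1 ∈ Ioc t T
  · rw [tsum_eq_single ⟨(x l).1, hl⟩]
    · simp [hl.1, hl.2]
    · intro s hs
      refine if_neg ?_
      rintro ⟨_, h, _⟩
      exact hs (Subtype.ext h.symm)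
  · rw [if_neg fun h => hl h.1, ENNReal.tsum_eq_zero]
    intro s
    refine if_neg ?_
    rintro ⟨_, h, _⟩
    exact hl (h ▸ s.2)

/-- A property of the fills that holds initially and persists under every fill that the rule allows
holds at all times. -/
lemma before_induction (x : Marks d n) {p : (Fin d → Side → ℕ) → Prop} (h0 : p 0)
    (hp : ∀ s n j k, rule s n (j, k) → p (n + oneFill j k)) (s : ℝ) : p (before rule x s) := by
  classical
  by_cases hne : (Finset.univ.filter fun l => (x l).1 < s ∧ Kept rule x l).Nonempty
  · obtain ⟨l, hl, hmax⟩ := Finset.exists_max_image _ (fun l => (x l).1) hne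
    simp only [Finset.mem_filter, Finset.mem_univ, true_and] at hl hmax
    have hk := (kept_iff x l).1 hl.2
    have : before rule x s = before rule x (x l).1 + oneFill (x l).2.1 (x l).2.2 := by
      ext j k
      rw [Pi.add_apply, Pi.add_apply, oneFill_apply, before, before,
        ← Finset.add_sum_erase _ _ (Finset.mem_univ l),
        ← Finset.add_sum_erase _ (fun i => if (x i).2 = (j, k) ∧ (x i).1 < (x l).1 ∧
          Kept rule x i then 1 else 0) (Finset.mem_univ l)]
      have h1 : ((x l).2 = (j, k)) ↔ (j = (x l).2.1 ∧ k = (x l).2.2) := by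
        rw [Prod.ext_iff]
        exact and_congr eq_comm eq_comm
      simp only [hl, lt_irrefl, and_true, and_false, if_false, zero_add, h1]
      rw [add_comm]
      congr 1
      refine Finset.sum_congr rfl fun i hi => ?_
      congr 1
      refine propext (and_congr_right fun _ => and_congr_left fun hik => ?_)
      constructor
      · intro h
        refine lt_of_le_of_ne (hmax i ⟨h, hik⟩) fun h' => ?_
        exact (Finset.mem_erase.1 hi).1 (hk.1 i h')
      · exact fun h => h.trans hl.1
    rw [this]
    exact hp _ _ _ _ hk.2
  · have : before rule x s = 0 := by
      ext j k
      refine Finset.sum_eq_zero fun l _ => if_neg ?_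
      rintro ⟨_, h2, h3⟩
      exact hne ⟨l, by simpa using ⟨h2, h3⟩⟩
    rw [this]
    exact h0

lemma measurableSet_rule_comp (hrule : ∀ n jk, MeasurableSet {s | rule s n jk}) {α : Type*}
    [MeasurableSpace α] {f : α → ℝ} {g : α → Fin d → Side → ℕ} {h : α → Fin d × Side}
    (hf : Measurable f) (hg : Measurable g) (hh : Measurable h) :
    MeasurableSet {a | rule (f a) (g a) (h a)} := by
  have : Measurable fun z : ℝ × ((Fin d → Side → ℕ) × (Fin d × Side)) =>
      rule z.1 z.2.1 z.2.2 :=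
    measurable_from_prod_countable_left fun z => measurableSet_setOfPred.1 (hrule z.1 z.2)
  exact measurableSet_setOfPred.2 (this.comp (hf.prodMk (hg.prodMk hh)))

lemma measurableSet_mark {α : Type*} [MeasurableSpace α] {f : α → Marks d n} (hf : Measurable f)
    (l : Fin n) (jk : Fin d × Side) : MeasurableSet {a | (f a l).2 = jk} :=
  measurable_snd.comp ((measurable_pi_apply l).comp hf) (measurableSet_singleton jk)

lemma measurable_time (l : Fin n) : Measurable fun x : Marks d n => (x l).1 :=
  measurable_fst.comp (measurable_pi_apply l)

lemma measurableSet_accept (hrule : ∀ n jk, MeasurableSet {s | rule s n jk}) (m : ℕ) :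
    ∀ i, MeasurableSet {x : Marks d n | Accept rule x m i} := by
  classical
  induction m with
  | zero => intro i; simp [Accept]
  | succ m ih =>
    intro i
    simp only [Accept]
    refine MeasurableSet.inter ?_ (measurableSet_rule_comp hrule (measurable_time i) ?_
      (measurable_snd.comp (measurable_pi_apply i)))
    · have : {x : Marks d n | ∀ l, (x l).1 = (x i).1 → l = i} =
          ⋂ l, {x : Marks d n | (x l).1 = (x i).1 → l = i} := by
        ext x
        simp
      change MeasurableSet {x : Marks d n | ∀ l, (x l).1 = (x i).1 → l = i}
      rw [this]
      refine MeasurableSet.iInter fun l => ?_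
      by_cases hl : l = i
      · simp [hl]
      · simp only [hl, imp_false]
        exact (measurableSet_eq_fun (measurable_time l) (measurable_time i)).compl
    · refine measurable_pi_lambda _ fun j => measurable_pi_lambda _ fun k =>
        Finset.measurable_fun_sum _ fun l _ => Measurable.ite ?_ measurable_const measurable_const
      exact (measurableSet_mark measurable_id l (j, k)).inter
        ((measurableSet_lt (measurable_time l) (measurable_time i)).inter (ih l))

lemma measurableSet_kept (hrule : ∀ n jk, MeasurableSet {s | rule s n jk}) (i : Fin n) :
    MeasurableSet {x : Marks d n | Kept rule x i} := measurableSet_accept hrule n i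

lemma measurable_before (hrule : ∀ n jk, MeasurableSet {s | rule s n jk}) :
    Measurable fun z : ℝ × Marks d n => before rule z.2 z.1 := by
  classical
  refine measurable_pi_lambda _ fun j => measurable_pi_lambda _ fun k =>
    Finset.measurable_fun_sum _ fun l _ => Measurable.ite ?_ measurable_const measurable_const
  exact (measurableSet_mark measurable_snd l (j, k)).inter
    ((measurableSet_lt ((measurable_time l).comp measurable_snd) measurable_fst).inter
      (measurable_snd (measurableSet_kept hrule l)))

lemma measurable_upTo (hrule : ∀ n jk, MeasurableSet {s | rule s n jk}) (s : ℝ) :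
    Measurable fun x : Marks d n => upTo rule x s := by
  classical
  refine measurable_pi_lambda _ fun j => measurable_pi_lambda _ fun k =>
    Finset.measurable_fun_sum _ fun l _ => Measurable.ite ?_ measurable_const measurable_const
  exact (measurableSet_mark measurable_id l (j, k)).inter
    ((measurableSet_le (measurable_time l) measurable_const).inter (measurableSet_kept hrule l))

end Marks

/-! ### The Poisson law, its filtration and the Mecke formula. -/

/-- Finite configurations of marked points. -/
abbrev MarkedConfig (d : ℕ) : Type := Σ n, Marks d n

namespace MarkedConfig

variable {d : ℕ}

lemma measurable_mk (n : ℕ) : Measurable (Sigma.mk n : Marks d n → MarkedConfig d) :=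
  fun _ hs => MeasurableSpace.measurableSet_iInf.1 hs n

lemma measurable_of_mk {β : Type*} [MeasurableSpace β] {f : MarkedConfig d → β}
    (hf : ∀ n, Measurable fun x : Marks d n => f ⟨n, x⟩) : Measurable f :=
  fun _ hs => MeasurableSpace.measurableSet_iInf.2 fun n => hf n hs

/-- The events that do not depend on the points after time `u`. -/
@[reducible]
def past (u : ℝ) : MeasurableSpace (MarkedConfig d) where
  MeasurableSet' A := MeasurableSet A ∧ ∀ n (x : Marks d n) i y, u < y.1 →
    ((⟨n + 1, Marks.insert i y x⟩ : MarkedConfig d) ∈ A ↔ (⟨n, x⟩ : MarkedConfig d) ∈ A)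
  measurableSet_empty := ⟨MeasurableSet.empty, fun _ _ _ _ _ => Iff.rfl⟩
  measurableSet_compl A hA := ⟨hA.1.compl, fun n x i y hy => not_congr (hA.2 n x i y hy)⟩
  measurableSet_iUnion A hA := ⟨MeasurableSet.iUnion fun m => (hA m).1, fun n x i y hy => by
    simp only [mem_iUnion]
    exact exists_congr fun m => (hA m).2 n x i y hy⟩

/-- The filtration of the past. -/
def pastFiltration (d : ℕ) :
    Filtration ℝ (inferInstance : MeasurableSpace (MarkedConfig d)) where
  seq := past
  mono' _ _ huv _ hA := ⟨hA.1, fun n x i y hy => hA.2 n x i y (huv.trans_lt hy)⟩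
  le' _ _ hA := hA.1

lemma measurable_past {u : ℝ} {β : Type*} [MeasurableSpace β] {f : MarkedConfig d → β}
    (hf : Measurable f) (h : ∀ n (x : Marks d n) i y, u < y.1 →
      f ⟨n + 1, Marks.insert i y x⟩ = f ⟨n, x⟩) : Measurable[pastFiltration d u] f :=
  fun B hB => ⟨hf hB, fun n x i y hy => by simp only [mem_preimage, h n x i y hy]⟩

lemma measurable_upTo_past {rule : ℝ → (Fin d → Side → ℕ) → Fin d × Side → Prop}
    (hrule : ∀ n jk, MeasurableSet {s | rule s n jk}) (j : Fin d) (k : Side) (s : ℝ) :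
    Measurable[pastFiltration d s] fun ω : MarkedConfig d => Marks.upTo rule ω.2 s j k :=
  measurable_past (measurable_of_mk fun _ => (measurable_pi_apply k).comp
      ((measurable_pi_apply j).comp (Marks.measurable_upTo hrule s)))
    fun n x i y hy => by
      change Marks.upTo rule (Marks.insert i y x) s j k = _
      rw [Marks.upTo_insert i y x hy]

/-- Predictable functions do not see the present and the future. -/
lemma predictable_insert {C : ℝ × MarkedConfig d → ℝ≥0∞}
    (hC : Measurable[predictableσ (pastFiltration d)] C) {n : ℕ} (x : Marks d n)
    (i : Fin (n + 1)) (y : ℝ × (Fin d × Side)) :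
    C (y.1, ⟨n + 1, Marks.insert i y x⟩) = C (y.1, ⟨n, x⟩) := by
  have key : ∀ B, MeasurableSet[predictableσ (pastFiltration d)] B →
      ((y.1, (⟨n + 1, Marks.insert i y x⟩ : MarkedConfig d)) ∈ B ↔
        (y.1, (⟨n, x⟩ : MarkedConfig d)) ∈ B) := by
    intro B hB
    induction B, hB using MeasurableSpace.generateFrom_induction with
    | hC B hB _ =>
      obtain ⟨u, A, hA, rfl⟩ := hB
      -- Membership in `Ioi u ×ˢ A` at time `y.1` forces `u < y.1`, exactly the case in which `A` is
      -- insensitive to inserting `y`.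
      exact and_congr_right fun hu => hA.2 n x i y hu
    | empty => exact Iff.rfl
    | compl B _ ih => exact not_congr ih
    | iUnion B _ ih =>
      simp only [mem_iUnion]
      exact exists_congr ih
  exact (key _ (hC (measurableSet_singleton (C (y.1, ⟨n, x⟩))))).2 rfl

variable (t T : ℝ) (Λ : Fin d → Side → ℝ)

/-- The measure `∑ Λ^{j,k} δ_{(j,k)}` on the marks. -/
noncomputable def markMeasure : Measure (Fin d × Side) :=
  ∑ jk : Fin d × Side, ENNReal.ofReal (Λ jk.1 jk.2) • Measure.dirac jk

instance : IsFiniteMeasure (markMeasure Λ) := by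
  refine ⟨?_⟩
  rw [markMeasure, Measure.finsetSum_apply]
  simp [ENNReal.sum_lt_top]

lemma lintegral_markMeasure (f : Fin d × Side → ℝ≥0∞) :
    ∫⁻ jk, f jk ∂(markMeasure Λ) = ∑ jk, ENNReal.ofReal (Λ jk.1 jk.2) * f jk := by
  rw [markMeasure, lintegral_finsetSum_measure]
  simp

/-- The intensity measure of the points. -/
noncomputable def pointMeasure : Measure (ℝ × (Fin d × Side)) :=
  (volume.restrict (Ioc t T)).prod (markMeasure Λ)

instance : IsFiniteMeasure (pointMeasure t T Λ) := by
  unfold pointMeasure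
  infer_instance

/-- The probability weight of a configuration of `n` points, relative to `pointMeasure ^ n`. -/
noncomputable def weight (n : ℕ) : ℝ≥0∞ :=
  ENNReal.ofReal (Real.exp (-(pointMeasure t T Λ).real univ) / n.factorial)

/-- The Poisson recursion on which the Mecke formula rests: it absorbs the choice of one of `n + 1`
points. -/
lemma weight_succ (n : ℕ) : weight t T Λ (n + 1) * (n + 1 : ℕ) = weight t T Λ n := by
  rw [weight, weight, ← ENNReal.ofReal_natCast, ← ENNReal.ofReal_mul (by positivity)]
  congr 1
  rw [Nat.factorial_succ]
  push_cast
  field_simp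

/-- The law of a Poisson point process with intensity `pointMeasure`. -/
noncomputable def law : Measure (MarkedConfig d) :=
  Measure.sum fun n => weight t T Λ n •
    (Measure.pi fun _ : Fin n => pointMeasure t T Λ).map (Sigma.mk n)

lemma lintegral_law {f : MarkedConfig d → ℝ≥0∞} (hf : Measurable f) :
    ∫⁻ ω, f ω ∂(law t T Λ) = ∑' n, weight t T Λ n *
      ∫⁻ x : Marks d n, f ⟨n, x⟩ ∂(Measure.pi fun _ : Fin n => pointMeasure t T Λ) := by
  rw [law, lintegral_sum_measure]
  refine tsum_congr fun n => ?_
  rw [lintegral_smul_measure, lintegral_map hf (measurable_mk n), smul_eq_mul]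

instance : IsProbabilityMeasure (law t T Λ) := by
  refine ⟨?_⟩
  rw [← lintegral_one, lintegral_law t T Λ measurable_const]
  set L := (pointMeasure t T Λ).real univ with hL
  have h1 : ∀ n, weight t T Λ n * ∫⁻ _ : Marks d n, 1
      ∂(Measure.pi fun _ : Fin n => pointMeasure t T Λ) =
      ENNReal.ofReal (Real.exp (-L) * (L ^ n / n.factorial)) := by
    intro n
    rw [lintegral_one, Measure.pi_univ, Finset.prod_const, Finset.card_univ, Fintype.card_fin,
      ← ofReal_measureReal (μ := pointMeasure t T Λ) (s := univ), weight, ← hL,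
      ← ENNReal.ofReal_pow measureReal_nonneg, ← ENNReal.ofReal_mul (by positivity)]
    congr 1
    ring
  have h2 : HasSum (fun n : ℕ => Real.exp (-L) * (L ^ n / n.factorial)) 1 := by
    have h3 := (NormedSpace.expSeries_div_hasSum_exp L).mul_left (Real.exp (-L))
    rwa [← Real.exp_eq_exp_ℝ, ← Real.exp_add, neg_add_cancel, Real.exp_zero] at h3
  have hL0 : 0 ≤ L := measureReal_nonneg
  simp only [h1]
  rw [← ENNReal.ofReal_tsum_of_nonneg (fun n => by positivity) h2.summable, h2.tsum_eq,
    ENNReal.ofReal_one]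

variable (rule : ℝ → (Fin d → Side → ℕ) → Fin d × Side → Prop)

open Classical in
/-- The fills have the intensity `Λ` whenever the rule admits fills. -/
lemma hasIntensity_upTo (hrule : ∀ n jk, MeasurableSet {s | rule s n jk})
    (j : Fin d) (k : Side) :
    HasIntensity (law t T Λ) (pastFiltration d) t T (fun s ω => Marks.upTo rule ω.2 s j k)
      (fun s ω => Λ j k * if rule s (Marks.before rule ω.2 s) (j, k) then 1 else 0) := by
  intro C hC
  have hC' : Measurable (Function.uncurry C) := hC.mono predictableσ_le le_rfl
  have hCn : ∀ n, Measurable fun z : ℝ × Marks d n => C z.1 ⟨n, z.2⟩ := fun n =>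
    hC'.comp (measurable_fst.prodMk ((measurable_mk n).comp measurable_snd))
  set ρ := pointMeasure t T Λ with hρ
  set G : ∀ n, Marks d n → Fin n → ℝ≥0∞ := fun n x l =>
    if (x l).1 ∈ Ioc t T ∧ (x l).2 = (j, k) ∧ Marks.Kept rule x l then C (x l).1 ⟨n, x⟩ else 0
    with hG
  have hGm : ∀ n l, Measurable fun x => G n x l := by
    intro n l
    refine Measurable.ite ?_ ((hCn n).comp ((Marks.measurable_time l).prodMk measurable_id))
      measurable_const
    exact (Marks.measurable_time l measurableSet_Ioc).inter
      ((Marks.measurableSet_mark measurable_id l (j, k)).inter (Marks.measurableSet_kept hrule l))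
  set H : ∀ n, ℝ × Marks d n → ℝ≥0∞ := fun n z => C z.1 ⟨n, z.2⟩ *
    ENNReal.ofReal (Λ j k * if rule z.1 (Marks.before rule z.2 z.1) (j, k) then 1 else 0) with hH
  have hHm : ∀ n, Measurable (H n) := by
    intro n
    refine (hCn n).mul (ENNReal.measurable_ofReal.comp (Measurable.const_mul
      (Measurable.ite ?_ measurable_const measurable_const) _))
    exact Marks.measurableSet_rule_comp hrule measurable_fst (Marks.measurable_before hrule)
      measurable_const
  have hleft : ∀ ω : MarkedConfig d, ∑' s : Ioc t T, C s ω *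
      (jumpAt (fun r => Marks.upTo rule ω.2 r j k) s : ℝ≥0∞) = ∑ l, G ω.1 ω.2 l :=
    fun ω => Marks.tsum_jumpAt_upTo t T ω.2 j k fun s => C s ω
  simp only [hleft]
  have hsum : Measurable fun ω : MarkedConfig d => ∑ l, G ω.1 ω.2 l :=
    measurable_of_mk fun n => by exact Finset.measurable_fun_sum Finset.univ fun l _ => hGm n l
  rw [lintegral_law t T Λ hsum,
    lintegral_law t T Λ (measurable_of_mk fun n => (hHm n).lintegral_prod_left'),
    -- The empty configuration has no fills; dropping it pairs `n + 1` points on the left with `n`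
    -- points on the right.
    tsum_eq_zero_add' ENNReal.summable]
  simp only [Finset.univ_eq_empty, Finset.sum_empty, lintegral_zero, mul_zero, zero_add]
  refine tsum_congr fun n => ?_
  -- The `i`-th point is integrated out. Given the others, it has almost surely no tie, so it is
  -- kept exactly when the rule allows it, and `C` at its time does not depend on it.
  have hmecke : ∀ i : Fin (n + 1),
      ∫⁻ x, G (n + 1) x i ∂(Measure.pi fun _ : Fin (n + 1) => ρ) =
      ∫⁻ x, (∫⁻ s in Ioc t T, H n (s, x)) ∂(Measure.pi fun _ : Fin n => ρ) := by
    intro i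
    have hins : Measurable fun z : (ℝ × (Fin d × Side)) × Marks d n => Marks.insert i z.1 z.2 :=
      (MeasurableEquiv.piFinSuccAbove (fun _ => ℝ × (Fin d × Side)) i).symm.measurable
    have h1 := (measurePreserving_piFinSuccAbove (fun _ : Fin (n + 1) => ρ)
      i).symm.lintegral_comp_emb (MeasurableEquiv.measurableEmbedding _)
      (fun x : Marks d (n + 1) => G (n + 1) x i)
    rw [← h1]
    change ∫⁻ z : (ℝ × (Fin d × Side)) × Marks d n, G (n + 1) (Marks.insert i z.1 z.2) i
      ∂(ρ.prod (Measure.pi fun _ : Fin n => ρ)) = _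
    have hGi : Measurable fun z : (ℝ × (Fin d × Side)) × Marks d n =>
        G (n + 1) (Marks.insert i z.1 z.2) i := (hGm (n + 1) i).comp hins
    refine (lintegral_prod_symm _ hGi.aemeasurable).trans ?_
    refine lintegral_congr fun x => ?_
    have hGx : Measurable fun y : ℝ × (Fin d × Side) => G (n + 1) (Marks.insert i y x) i :=
      hGi.comp measurable_prodMk_right
    refine (lintegral_prod _ hGx.aemeasurable).trans ?_
    have hties : ∀ᵐ s ∂(volume : Measure ℝ), ∀ l, (x l).1 ≠ s := by
      rw [ae_all_iff]
      intro l
      rw [ae_iff]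
      simp
    refine lintegral_congr_ae ?_
    filter_upwards [ae_restrict_mem measurableSet_Ioc, ae_restrict_of_ae hties] with s hs hsx
    rw [lintegral_markMeasure, Finset.sum_eq_single (j, k)]
    · simp only [hG, hH, Marks.insert_same, Marks.kept_insert_same, hs,
        true_and]
      have h2 : C s ⟨n + 1, Marks.insert i (s, (j, k)) x⟩ = C s ⟨n, x⟩ :=
        predictable_insert hC x i (s, (j, k))
      rw [h2]
      by_cases hr : rule s (Marks.before rule x s) (j, k)
      · rw [if_pos ⟨hsx, hr⟩, if_pos hr, mul_one, mul_comm]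
      · rw [if_neg fun h => hr h.2, if_neg hr]
        simp
    · intro jk _ hjk
      simp [hG, hjk]
    · simp
  have hadd : ∫⁻ x, ∑ l, G (n + 1) x l ∂(Measure.pi fun _ : Fin (n + 1) => ρ) =
      ∑ l, ∫⁻ x, G (n + 1) x l ∂(Measure.pi fun _ : Fin (n + 1) => ρ) :=
    lintegral_finsetSum _ fun i _ => hGm (n + 1) i
  refine (congrArg (weight t T Λ (n + 1) * ·) hadd).trans ?_
  rw [Finset.sum_congr rfl fun i _ => hmecke i, Finset.sum_const, Finset.card_univ,
    Fintype.card_fin, nsmul_eq_mul, ← mul_assoc, weight_succ]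

end MarkedConfig

/-! ### The system that follows the feedback rule. -/

namespace Market

variable {d : ℕ} (M : Market d) (v : ℝ → (Fin d → ℝ) → ℝ) (t : ℝ) (q : Fin d → ℝ)

/-- The feedback rule on `(t, T] × 𝒬`, in terms of the fills. -/
def fillRule (s : ℝ) (n : Fin d → Side → ℕ) (jk : Fin d × Side) : Prop :=
  s ∈ Ioc t M.T ∧ M.inventory q n ∈ M.inventories ∧
    M.feedback v s (M.inventory q n) jk.1 jk.2 = 1

variable {M v t q}

lemma feedback_eq_one_iff {s : ℝ} {x : Fin d → ℝ} {j : Fin d} {k : Side} :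
    M.feedback v s x j k = 1 ↔ x j + k.sign * M.m j ∈ M.levels j ∧
      (v s x - v s (M.shift x j k)) / M.m j ≤ M.D j / 2 := by
  unfold feedback
  split_ifs with h <;> simp [h]

/-- Nothing is known of `v` off `[0,T] × 𝒬`, so the rule is expressed through the measurable
extension `ofFills`; when the position or the next one is off `𝒬` the set is empty. -/
lemma measurableSet_fillRule (hv : M.IsHJBSolution v) (ht : 0 ≤ t) (n : Fin d → Side → ℕ)
    (jk : Fin d × Side) : MeasurableSet {s | M.fillRule v t q s n jk} := by
  by_cases h : M.inventory q n ∈ M.inventories ∧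
      M.inventory q n jk.1 + jk.2.sign * M.m jk.1 ∈ M.levels jk.1
  · have : {s | M.fillRule v t q s n jk} = Ioc t M.T ∩ {s | (M.ofFills v q s n -
        M.ofFills v q s (n + oneFill jk.1 jk.2)) / M.m jk.1 ≤ M.D jk.1 / 2} := by
      ext s
      refine and_congr_right fun hs => ?_
      have hs' : s ∈ Icc 0 M.T := ⟨ht.trans hs.1.le, hs.2⟩
      rw [feedback_eq_one_iff]
      simp only [mem_ofPred_eq, h, true_and]
      rw [ofFills_of_mem hs' h.1, ofFills_of_mem hs', inventory_add_oneFill]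
      rw [inventory_add_oneFill]
      exact M.shift_mem_inventories h.1 h.2
    rw [this]
    exact measurableSet_Ioc.inter (measurableSet_le
      (((measurable_ofFills hv.continuousOn _).sub
        (measurable_ofFills hv.continuousOn _)).div_const _) measurable_const)
  · convert MeasurableSet.empty
    refine eq_empty_iff_forall_notMem.2 ?_
    rintro s ⟨_, h1, h2⟩
    exact h ⟨h1, (feedback_eq_one_iff.1 h2).1⟩

open Classical in
/-- The market driven by a thinned Poisson point process in which the feedback rule is followed. -/
noncomputable def feedbackSystem (hv : M.IsHJBSolution v) (ht : 0 ≤ t) :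
    ControlledSystem M t q where
  Ω := MarkedConfig d
  mΩ := inferInstance
  P := MarkedConfig.law t M.T M.Λ
  isProbability := inferInstance
  𝓕 := MarkedConfig.pastFiltration d
  N j k s ω := Marks.upTo (M.fillRule v t q) ω.2 s j k
  l j k s ω := if M.fillRule v t q s (Marks.before (M.fillRule v t q) ω.2 s) (j, k) then 1 else 0
  adapted j k s := MarkedConfig.measurable_upTo_past (measurableSet_fillRule hv ht) j k s
  counting j k ω := Marks.isCountingPath_upTo (fun s n jk h => h.1.1) ω.2 j k
  no_common_jumps ω s j k j' k' h h' := by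
    rw [Marks.jumpAt_upTo] at h h'
    exact Marks.eq_of_atTime_ne_zero h h'
  control_mem j k s ω := by
    split_ifs <;> simp
  control_predictable j k := by
    have hb : Measurable[predictableσ (MarkedConfig.pastFiltration d)]
        fun z : ℝ × MarkedConfig d => Marks.before (M.fillRule v t q) z.2.2 z.1 := by
      refine @measurable_pi_lambda _ _ _ (predictableσ _) _ _ fun j =>
        @measurable_pi_lambda _ _ _ (predictableσ _) _ _ fun k => ?_
      have := measurable_leftLim_predictableσ (𝓕 := MarkedConfig.pastFiltration d)
        (N := fun s (ω : MarkedConfig d) => Marks.upTo (M.fillRule v t q) ω.2 s j k) (t := t)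
        (MarkedConfig.measurable_upTo_past (measurableSet_fillRule hv ht) j k)
        (fun ω => Marks.isCountingPath_upTo (fun s n jk h => h.1.1) ω.2 j k)
      simpa only [Marks.leftLim_upTo] using this
    have hset : MeasurableSet[predictableσ (MarkedConfig.pastFiltration d)]
        {z : ℝ × MarkedConfig d | M.fillRule v t q z.1
          (Marks.before (M.fillRule v t q) z.2.2 z.1) (j, k)} :=
      @Marks.measurableSet_rule_comp _ _ (measurableSet_fillRule hv ht) _ (predictableσ _) _ _ _
        measurable_fst_predictableσ hb measurable_const
    exact Measurable.ite hset measurable_const measurable_const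
  intensity j k := by
    intro C hC
    rw [MarkedConfig.hasIntensity_upTo t M.T M.Λ (M.fillRule v t q)
      (measurableSet_fillRule hv ht) j k C hC]
    refine lintegral_congr fun ω => lintegral_congr_ae ?_
    -- The prescribed intensity reads the inventory at `s`, the constructed one just before `s`;
    -- they differ only at the finitely many points of `ω`.
    have hties : ∀ᵐ s ∂(volume : Measure ℝ), ∀ l, (ω.2 l).1 ≠ s := by
      rw [ae_all_iff]
      intro l
      rw [ae_iff]
      simp
    filter_upwards [ae_restrict_of_ae hties] with s hs
    have h1 : (fun i h => Marks.upTo (M.fillRule v t q) ω.2 s i h) =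
        Marks.before (M.fillRule v t q) ω.2 s := by
      ext j k
      rw [Marks.upTo_eq, Nat.add_eq_left]
      by_contra h
      obtain ⟨l, _, h2, _⟩ := Marks.atTime_ne_zero.1 h
      exact hs l h2
    rw [h1]
    split_ifs with hr
    · rw [M.room_of_mem (feedback_eq_one_iff.1 hr.2.2).1]
      simp
    · simp

/-- The rule must hold for every `ω`, not almost every one. Allowed fills keep the inventory in `𝒬`
on every path, so the membership clause in `fillRule` is automatic. -/
lemma feedbackSystem_followsFeedback (hv : M.IsHJBSolution v) (ht : 0 ≤ t)
    (hq : q ∈ M.inventories) :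
    (feedbackSystem (q := q) hv ht).FollowsFeedback v := by
  classical
  intro s hs ω j k
  have h1 : (feedbackSystem (q := q) hv ht).invLeft s ω =
      M.inventory q (Marks.before (M.fillRule v t q) ω.2 s) := by
    rw [ControlledSystem.invLeft]
    congr 1
    ext j k
    exact Marks.leftLim_upTo _ _ _ _
  have h2 : M.inventory q (Marks.before (M.fillRule v t q) ω.2 s) ∈ M.inventories := by
    refine Marks.before_induction ω.2 (p := fun n => M.inventory q n ∈ M.inventories) ?_ ?_ s
    · rwa [inventory_zero]
    · intro s n j k h
      rw [inventory_add_oneFill]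
      exact M.shift_mem_inventories h.2.1 (feedback_eq_one_iff.1 h.2.2).1
  rw [h1]
  change (if M.fillRule v t q s (Marks.before (M.fillRule v t q) ω.2 s) (j, k) then (1 : ℝ)
    else 0) = _
  by_cases h : M.feedback v s (M.inventory q (Marks.before (M.fillRule v t q) ω.2 s)) j k = 1
  · rw [if_pos ⟨hs, h2, h⟩, h]
  · rw [if_neg fun h' => h h'.2.2]
    rw [feedback_eq_one_iff] at h
    rw [feedback, if_neg h]

end Market

theorem mainTheorem2 {d : ℕ} (M : Market d) (v : ℝ → (Fin d → ℝ) → ℝ) (hv : M.IsHJBSolution v)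
    (t : ℝ) (ht : t ∈ Set.Icc 0 M.T) (q : Fin d → ℝ) (hq : q ∈ M.inventories) :
    (∀ S : ControlledSystem M t q, @MeasureTheory.Integrable ℝ _ _ S.Ω S.mΩ S.payoff S.P) ∧
    (∃ S : ControlledSystem M t q, S.FollowsFeedback v) ∧
    (∀ S : ControlledSystem M t q, S.FollowsFeedback v →
      ∀ S' : ControlledSystem M t q, S'.performance ≤ S.performance) ∧
    IsLUB (Set.range fun S : ControlledSystem M t q => S.performance) (v t q) := by
  have hex := Market.feedbackSystem_followsFeedback (q := q) hv ht.1 hq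
  refine ⟨fun S => S.integrable_payoff ht.2 hq, ⟨_, hex⟩, fun S hS S' => ?_, ?_, ?_⟩
  · rw [S.performance_of_followsFeedback hv ht hq hS]
    exact S'.performance_le hv ht hq
  · rintro _ ⟨S, rfl⟩
    exact S.performance_le hv ht hq
  · intro b hb
    -- The supremum is attained: `v t q` is itself the performance of the constructed system.
    rw [← ControlledSystem.performance_of_followsFeedback _ hv ht hq hex]
    exact hb ⟨_, rfl⟩
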